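/- Setting. Let $A=\mathbb C[x_1,\dots,x_N]$, let $(\mathbb C^*)^N$ act on $A$ by ${}^g x_i=\lambda_i x_i$ for $g=(\lambda_1,\dots,\lambda_N)$, let $W\in A$, let $G\subseteq(\mathbb C^*)^N$ be a subgroup preserving $W$, and let $\mathrm{Jac}(W)=A/(\partial W/\partial x_1,\dots,\partial W/\partial x_N)$. For $g=(\lambda_1,\dots,\lambda_N)$ put $g^{(i)}=(1,\dots,\lambda_i,\dots,1)$, and let $\tilde G$ be the group generated by all $g^{(i)}$, $g\in G$. For a subgroup $S$ of the torus, $A[S]$ is the crossed product, $(ag)(bh)=(a\,{}^gb)gh$; $e$ denotes the identity element. Let $\bar A=A/\mathbb C$ and $C^p(\bar A,A[S])=\mathrm{Hom}_{\mathbb C}(\bar A^{\otimes p},A[S])$, with cup product $(\phi\cup\psi)(a_1\otimes\cdots\otimes a_{p+q})=\phi(a_1\otimes\cdots\otimes a_p)\,\psi(a_{p+1}\otimes\cdots\otimes a_{p+q})$ and curving differential $$(\mathsf d_W\phi)(a_1\otimes\cdots\otimes a_n)=\sum_{i=0}^{n}(-1)^i\phi(a_1\otimes\cdots\otimes a_i\otimes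 W\otimes a_{i+1}\otimes\cdots\otimes a_n)$$ for $\phi$ of degree $n+1$, and $\mathsf d_W=0$ in degree $0$. Let $K^p(A,A[S])$ be the space of sums $\sum_I c_I e_{i_1}\cdots e_{i_p}$ over $I=(i_1<\dots<i_p)$, with $c_I\in A[S]$ ($e_{i_1}\cdots e_{i_p}g$ has $c_I=g$). For a monomial $a=x^\gamma$ and an index $i$ let $D_i(a)=\sum_{0\le s<\gamma_i}x_i^{\gamma_i-1-s}x_{i+1}^{\gamma_{i+1}}\cdots x_N^{\gamma_N}\otimes x_1^{\gamma_1}\cdots x_{i-1}^{\gamma_{i-1}}x_i^{s}\in A\otimes A$, extended linearly to $A$ (it kills constants), and for $I=(i_1<\dots<i_p)$ let $D_I(a_1\otimes\cdots\otimes a_p)=D_{i_1}(a_1)\cdots D_{i_p}(a_p)\in A\otimes A$. Writing $D_I=\sum u\otimes v$, define $$\Upsilon^*\Big(\sum_I c_I e_I\Big)(a_1\otimes\cdots\otimes a_p)=\sum_I\sum u\,c_I\,v,\qquad \Phi^*(\phi)=\sum_{I}\sum_{\sigma\in S_p}\mathrm{sgn}(\sigma)\,\phi(x_{i_{\sigma(1)}}\otimes\cdots\otimes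 x_{i_{\sigma(p)}})\,e_{i_1}\cdots e_{i_p},$$ $$\mathsf H^*(\phi)(a_1\otimes\cdots\otimes a_n)=\sum_{r=1}^{n+1}(-1)^r\sum_{I=(i_1<\cdots<i_{m})}\ \sum_{\sigma\in S_{m}}\mathrm{sgn}(\sigma)\sum\phi(a_1\otimes\cdots\otimes a_{r-1}\otimes u\otimes x_{i_{\sigma(1)}}\otimes\cdots\otimes x_{i_{\sigma(m)}})\,v$$ for $\phi\in C^{n+1}$, where $m=n-r+1$ and $\sum u\otimes v=D_I(a_r\otimes\cdots\otimes a_n)$; $\mathsf H^*=0$ on $C^0$. On $\bigoplus_p C^p(\bar A,A[G])$ put $$\tilde\Phi^*=\Phi^*-\Phi^*(\mathrm{id}+\mathsf d_W\mathsf H^*)^{-1}\mathsf d_W\mathsf H^*,\qquad(\mathrm{id}+\mathsf d_W\mathsf H^*)^{-1}=\sum_{m\ge0}(-1)^m(\mathsf d_W\mathsf H^*)^m .$$ Let $\mathsf p$ send an element of $\bigoplus_pK^p(A,A[G])$ to the class in $\mathrm{Jac}(W)$ of the coefficient, in $A=Ae$, of its degree-zero component. Let $\partial^g_{x_i}$ be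 the linear operator on $A$ with $\partial^g_{x_i}x^\gamma=(1+\lambda_i+\cdots+\lambda_i^{\gamma_i-1})\,x_1^{\gamma_1}\cdots x_i^{\gamma_i-1}\cdots x_N^{\gamma_N}$ (zero if $\gamma_i=0$). Put $\partial^g_i(a)=\partial^g_{x_i}(a)\,g^{(i)}$, a cochain in $C^1(\bar A,A[\tilde G])$, and let the second order quantum differential operators be $\partial^{g,h}_{i,j}(a)=\partial^g_{x_i}(\partial^h_{x_j}a)\,g^{(i)}h^{(j)}$ for $i\ne j$ and $\partial^{g,h}_{i,i}=-\mathsf H^*(\partial^g_i\cup\partial^h_i)$. Write $g^{(i,j)}=g^{(i)}g^{(i+1)}\cdots g^{(j)}$ for $i\le j$, and $g^{(i,j)}=e$ if $i>j$. **Theorem.** Let $g\in G$, $i_1<\dots<i_p$, $j_1<\dots<j_q$ in $\{1,\dots,N\}$, and $$\phi=\Upsilon^*(e_{i_1}\cdots e_{i_p}g)\cup\Upsilon^*(e_{j_1}\cdots e_{j_q}g^{-1}).$$ (1) If $p\ne q$, then $\mathsf p\circ\tilde\Phi^*(\phi)=0$ in $\mathrm{Jac}(W)$. (2) If $p=q$,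 let $V=\{\sigma\in S_p\mid j_{\sigma(k)}\le i_k,\ 1\le k\le p\}$. Then the element $$(-1)^{\frac{p(p-1)}2}\sum_{\sigma\in V}\mathrm{sgn}(\sigma)\;g^{(j_{\sigma(1)},i_1-1)}\,\partial^{g,g^{-1}}_{i_1,j_{\sigma(1)}}(W)\,(g^{-1})^{(j_{\sigma(1)}+1,i_1)}\cdots g^{(j_{\sigma(p)},i_p-1)}\,\partial^{g,g^{-1}}_{i_p,j_{\sigma(p)}}(W)\,(g^{-1})^{(j_{\sigma(p)}+1,i_p)}$$ of $A[\tilde G]$ lies in the identity sector $Ae=A$, and its class in $\mathrm{Jac}(W)$ equals $\mathsf p\circ\tilde\Phi^*(\phi)$. -/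

import Mathlib

open scoped TensorProduct DirectSum

noncomputable section

namespace OrbifoldLG

/-! ### The polynomial ring, the torus acting on it, and the crossed product -/

/-- `A = ℂ[x₁, …, x_N]`. -/
abbrev Poly (N : ℕ) : Type := MvPolynomial (Fin N) ℂ

/-- The torus `(ℂ^*)^N`. -/
def Torus (N : ℕ) : Type := Fin N → ℂˣ

instance (N : ℕ) : CommGroup (Torus N) := inferInstanceAs (CommGroup (Fin N → ℂˣ))

/-- The algebra endomorphism `a ↦ ᵍa` of `A` with `ᵍx_i = λ_i x_i` for `g = (λ₁, …, λ_N)`. -/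
def torusAct {N : ℕ} (g : Torus N) : Poly N →ₐ[ℂ] Poly N :=
  MvPolynomial.aeval fun i => MvPolynomial.C (g i : ℂ) * MvPolynomial.X i

theorem torusAct_one {N : ℕ} (a : Poly N) : torusAct (1 : Torus N) a = a := by
  have h : torusAct (1 : Torus N) = AlgHom.id ℂ (Poly N) := by
    ext i : 1
    have : ((1 : Torus N) i : ℂ) = 1 := rfl
    simp [torusAct, this]
  rw [h]; rfl

theorem torusAct_mul {N : ℕ} (g h : Torus N) (a : Poly N) :
    torusAct (g * h) a = torusAct g (torusAct h a) := by
  have e : torusAct (g * h) = (torusAct g).comp (torusAct h) := by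
    ext i : 1
    have : ((g * h) i : ℂ) = (g i : ℂ) * (h i : ℂ) := rfl
    simp only [torusAct, MvPolynomial.aeval_X, AlgHom.comp_apply, map_mul, this,
      MvPolynomial.aeval_C, MvPolynomial.algebraMap_eq]
    ring
  rw [e]; rfl

/-- The action of the torus on `A` by algebra automorphisms. -/
instance (N : ℕ) : MulSemiringAction (Torus N) (Poly N) where
  smul g a := torusAct g a
  one_smul := torusAct_one
  mul_smul := torusAct_mul
  smul_zero g := map_zero (torusAct g)
  smul_add g := map_add (torusAct g)
  smul_one g := map_one (torusAct g)
  smul_mul g := map_mul (torusAct g)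

theorem torus_smul_def {N : ℕ} (g : Torus N) (a : Poly N) : g • a = torusAct g a := rfl

/-- The crossed product algebra `A[S]`, with `(a g)(b h) = (a ᵍb) gh`; the element `a g` is
`SkewMonoidAlgebra.single g a`. -/
abbrev Crossed {N : ℕ} (S : Subgroup (Torus N)) : Type := SkewMonoidAlgebra (Poly N) S

/-- The `i`-th component `g^{(i)} = (1, …, q_i, …, 1)` of `g = (q₁, …, q_N)`. -/
def component {N : ℕ} (g : Torus N) (i : Fin N) : Torus N :=
  (Pi.mulSingle i (g i) : Fin N → ℂˣ)

/-- The group `G̃` generated by the components of the elements of `G`. -/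
def tildeGroup {N : ℕ} (G : Subgroup (Torus N)) : Subgroup (Torus N) :=
  Subgroup.closure {t | ∃ g ∈ G, ∃ i, t = component g i}

/-- `g^{(i)}` as an element of `G̃`. -/
def tildeComponent {N : ℕ} {G : Subgroup (Torus N)} (g : G) (i : Fin N) : tildeGroup G :=
  ⟨component (g : Torus N) i, Subgroup.subset_closure ⟨g, g.2, i, rfl⟩⟩


variable {N : ℕ} {S : Subgroup (Torus N)}

instance : SMulCommClass S ℂ (Poly N) :=
  ⟨fun g c a => map_smul (torusAct (g : Torus N)) c a⟩

instance : IsScalarTower ℂ (Crossed S) (Crossed S) :=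
  ⟨fun c x y => by
    have h (z : Crossed S) : c • z = (MvPolynomial.C c : Poly N) • z := by
      rw [← MvPolynomial.algebraMap_eq, algebraMap_smul]
    rw [h x, h (x • y), smul_assoc]⟩

instance : SMulCommClass ℂ (Crossed S) (Crossed S) :=
  ⟨fun c x y => by
    simp only [smul_eq_mul]
    refine SkewMonoidAlgebra.induction_on
      (p := fun x => c • (x * y) = x * (c • y)) x (by simp) (fun g a => ?_) (fun u v hu hv => ?_)
    · refine SkewMonoidAlgebra.induction_on
        (p := fun y => c • (SkewMonoidAlgebra.single g a * y)
          = SkewMonoidAlgebra.single g a * (c • y)) y (by simp) (fun h b => ?_)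
        (fun u v hu hv => ?_)
      · simp only [SkewMonoidAlgebra.single_mul_single, SkewMonoidAlgebra.smul_single]
        rw [smul_comm g c b, Algebra.mul_smul_comm]
      · rw [mul_add, smul_add, hu, hv, smul_add, mul_add]
    · rw [add_mul, smul_add, hu, hv, add_mul]⟩

/-- The left and right actions of `A` on `A[S]` are multiplications by elements of the identity
sector; this is the inclusion `A = A e → A[S]`. -/
def inclA (S : Subgroup (Torus N)) : Poly N →ₗ[ℂ] Crossed S := SkewMonoidAlgebra.lsingle ℂ 1

/-! ### Reduced twisted Hochschild cochains -/

/-- `Ā = A / ℂ`. -/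
abbrev Abar (N : ℕ) : Type := Poly N ⧸ Submodule.span ℂ ({1} : Set (Poly N))

/-- The projection `A → Ā`. -/
abbrev toAbar : Poly N →ₗ[ℂ] Abar N := Submodule.mkQ _

/-- A linear map on `A` that kills the constants, as a map on `Ā`. -/
def descend {M : Type*} [AddCommGroup M] [Module ℂ M] (f : Poly N →ₗ[ℂ] M) (hf : f 1 = 0) :
    Abar N →ₗ[ℂ] M :=
  Submodule.liftQ _ f (by rw [Submodule.span_singleton_le_iff_mem]; exact hf)

/-- Reduced `p`-cochains `C^p(Ā, A[S]) = Hom_ℂ(Ā^{⊗ p}, A[S])`, as multilinear maps. -/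
abbrev Cochain (S : Subgroup (Torus N)) (p : ℕ) : Type :=
  MultilinearMap ℂ (fun _ : Fin p => Abar N) (Crossed S)

/-- The cup product
`(φ ∪ ψ)(a₁ ⊗ ⋯ ⊗ a_{p+q}) = φ(a₁ ⊗ ⋯ ⊗ a_p) ψ(a_{p+1} ⊗ ⋯ ⊗ a_{p+q})`, product in `A[S]`. -/
def cup {p q : ℕ} (φ : Cochain S p) (ψ : Cochain S q) : Cochain S (p + q) :=
  ((LinearMap.mul' ℂ (Crossed S)).compMultilinearMap (φ.domCoprod ψ)).domDomCongr finSumFinEquiv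

theorem cup_apply {p q : ℕ} (φ : Cochain S p) (ψ : Cochain S q) (a : Fin (p + q) → Abar N) :
    cup φ ψ a = φ (fun k => a (Fin.castAdd q k)) * ψ (fun k => a (Fin.natAdd p k)) := by
  simp [cup]

/-- The curving differential `d_W φ = φ{m₀}`:
`(d_W φ)(a₁ ⊗ ⋯ ⊗ a_n) = ∑_{i=0}^{n} (-1)^i φ(a₁ ⊗ ⋯ ⊗ a_i ⊗ W ⊗ a_{i+1} ⊗ ⋯ ⊗ a_n)`. -/
def dW (W : Poly N) {n : ℕ} : Cochain S (n + 1) →ₗ[ℂ] Cochain S n where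
  toFun φ := ∑ i : Fin (n + 1), (-1 : ℂ) ^ (i : ℕ) • φ.curryMid i (toAbar W)
  map_add' φ ψ := by
    rw [← Finset.sum_add_distrib]
    refine Finset.sum_congr rfl fun i _ => ?_
    rw [← smul_add]; rfl
  map_smul' c φ := by
    rw [RingHom.id_apply, Finset.smul_sum]
    refine Finset.sum_congr rfl fun i _ => ?_
    rw [smul_comm c]; rfl

theorem dW_apply (W : Poly N) {n : ℕ} (φ : Cochain S (n + 1)) (a : Fin n → Abar N) :
    dW W φ a = ∑ i : Fin (n + 1), (-1 : ℂ) ^ (i : ℕ) • φ (i.insertNth (toAbar W) a) := by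
  simp [dW]

/-! ### Koszul cochains and the comparison maps -/

/-- Koszul cochains `K^p(A, A[S])`: the element `∑_I c_I e_{i₁} ⋯ e_{i_p}`, over
`I = (i₁ < ⋯ < i_p)` and with `c_I ∈ A[S]`, is the function `I ↦ c_I`. -/
abbrev Koszul (S : Subgroup (Torus N)) (p : ℕ) : Type := (Fin p ↪o Fin N) → Crossed S

/-- The Koszul cochain `e_{i₁} ⋯ e_{i_p} g`. -/
def koszulGen {p : ℕ} (I : Fin p ↪o Fin N) (g : S) : Koszul S p :=
  by classical exact Pi.single I (SkewMonoidAlgebra.single g 1)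

/-- The splitting of a monomial `x^γ` at the variable `x_i`: the map `A → A ⊗ A` with
`x^γ ↦ ∑_{0 ≤ s < γ_i} a¹_s ⊗ a²_s`, where `a²_s = x₁^{γ₁} ⋯ x_{i-1}^{γ_{i-1}} x_i^s` and
`a¹_s = x_i^{γ_i-1-s} x_{i+1}^{γ_{i+1}} ⋯ x_N^{γ_N}`. -/
def split (i : Fin N) : Poly N →ₗ[ℂ] Poly N ⊗[ℂ] Poly N :=
  (MvPolynomial.basisMonomials (Fin N) ℂ).constr ℂ fun γ =>
    ∑ s ∈ Finset.range (γ i),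
      MvPolynomial.monomial (Finsupp.single i (γ i - 1 - s) + γ.filter (i < ·)) (1 : ℂ) ⊗ₜ[ℂ]
        MvPolynomial.monomial (γ.filter (· < i) + Finsupp.single i s) (1 : ℂ)

theorem split_one (i : Fin N) : split i (1 : Poly N) = 0 := by
  have h : (1 : Poly N) = MvPolynomial.basisMonomials (Fin N) ℂ 0 := by simp
  rw [h, split, Module.Basis.constr_basis]; simp

/-- The splitting at `x_i` as a map on `Ā`. -/
def splitBar (i : Fin N) : Abar N →ₗ[ℂ] Poly N ⊗[ℂ] Poly N := descend (split i) (split_one i)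

/-- The coefficient in `A ⊗ A` of `e^{i₁} ⋯ e^{i_p}` in `Υ_p(1 ⊗ a₁ ⊗ ⋯ ⊗ a_p ⊗ 1)`, which is
`∑_s a¹₁ ⋯ a¹_p ⊗ a²₁ ⋯ a²_p`, as a multilinear map in the `a_k`. -/
def upsilonCoeff {p : ℕ} (I : Fin p ↪o Fin N) :
    MultilinearMap ℂ (fun _ : Fin p => Abar N) (Poly N ⊗[ℂ] Poly N) :=
  (MultilinearMap.mkPiAlgebra ℂ (Fin p) (Poly N ⊗[ℂ] Poly N)).compLinearMap
    fun k => splitBar (I k)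

/-- For a linear map `f : A → A[S]`, the map `A ⊗ A → A[S]`, `u ⊗ v ↦ f(u) v`. -/
def contract : (Poly N →ₗ[ℂ] Crossed S) →ₗ[ℂ] (Poly N ⊗[ℂ] Poly N →ₗ[ℂ] Crossed S) :=
  (TensorProduct.lift.equiv (RingHom.id ℂ) (Poly N) (Poly N) (Crossed S)).toLinearMap ∘ₗ
    LinearMap.llcomp ℂ (Poly N) (Crossed S) (Poly N →ₗ[ℂ] Crossed S)
      ((LinearMap.mul ℂ (Crossed S)).compl₂ (inclA S))

theorem contract_tmul (f : Poly N →ₗ[ℂ] Crossed S) (u v : Poly N) :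
    contract f (u ⊗ₜ[ℂ] v) = f u * inclA S v := rfl

/-- The map `Υ^* : K^p(A, A[S]) → C^p(Ā, A[S])`:
`Υ^*(ψ)(a₁ ⊗ ⋯ ⊗ a_p) = ψ(Υ(1 ⊗ a₁ ⊗ ⋯ ⊗ a_p ⊗ 1)) = ∑_I ∑_s a¹₁ ⋯ a¹_p ψ_I a²₁ ⋯ a²_p`. -/
def upsilonStar {p : ℕ} (ψ : Koszul S p) : Cochain S p :=
  ∑ I : Fin p ↪o Fin N,
    (contract ((LinearMap.mulRight ℂ (ψ I)) ∘ₗ inclA S)).compMultilinearMap (upsilonCoeff I)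

/-- The map `Φ^* : C^p(Ā, A[S]) → K^p(A, A[S])`:
`Φ^*(φ) = ∑_I ∑_σ sgn(σ) φ(x_{i_{σ(1)}} ⊗ ⋯ ⊗ x_{i_{σ(p)}}) e_{i₁} ⋯ e_{i_p}`. -/
def phiStar {p : ℕ} : Cochain S p →ₗ[ℂ] Koszul S p where
  toFun φ I := ∑ σ : Equiv.Perm (Fin p),
    ((Equiv.Perm.sign σ : ℤ) : ℂ) • φ fun k => toAbar (MvPolynomial.X (I (σ k)))
  map_add' φ ψ := by
    funext I
    simp only [add_apply, smul_add, Finset.sum_add_distrib, Pi.add_apply]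
  map_smul' c φ := by
    funext I
    simp only [smul_apply, RingHom.id_apply, Pi.smul_apply, Finset.smul_sum]
    exact Finset.sum_congr rfl fun σ _ => smul_comm _ _ _

/-! ### The homotopy -/

/-- The arguments `a₁, …, a_i, *, x_{i_{σ(1)}}, …, x_{i_{σ(n-i)}}`; the entry `*` at position `i`
(counted from `0`) is a placeholder. -/
def homotopyArgs {n : ℕ} (i : Fin (n + 1)) (I : Fin (n - i) ↪o Fin N)
    (σ : Equiv.Perm (Fin (n - i))) (a : Fin n → Abar N) : Fin (n + 1) → Abar N := fun k =>
  if h : k < i then a ⟨k, by omega⟩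
  else if h' : i < k then toAbar (MvPolynomial.X (I (σ ⟨k - i - 1, by omega⟩)))
  else 0

/-- The arguments `a_{i+1}, …, a_n`. -/
def homotopyTail {n : ℕ} (i : Fin (n + 1)) (a : Fin n → Abar N) : Fin (n - i) → Abar N :=
  fun k => a ⟨i + k, by omega⟩

theorem homotopyArgs_update_of_lt {n : ℕ} (i : Fin (n + 1)) (I : Fin (n - i) ↪o Fin N)
    (σ : Equiv.Perm (Fin (n - i))) (a : Fin n → Abar N) (j : Fin n) (x : Abar N)
    (hj : (j : ℕ) < i) :
    homotopyArgs i I σ (Function.update a j x) =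
      Function.update (homotopyArgs i I σ a) j.castSucc x := by
  funext k
  by_cases hk : k = j.castSucc
  · subst hk
    have h : j.castSucc < i := hj
    simp [homotopyArgs, h]
  · rw [Function.update_of_ne hk]
    unfold homotopyArgs
    split_ifs with h
    · rw [Function.update_of_ne]
      intro e
      exact hk (Fin.ext (by simpa using congrArg Fin.val e))
    · rfl
    · rfl

theorem homotopyArgs_update_of_le {n : ℕ} (i : Fin (n + 1)) (I : Fin (n - i) ↪o Fin N)
    (σ : Equiv.Perm (Fin (n - i))) (a : Fin n → Abar N) (j : Fin n) (x : Abar N)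
    (hj : (i : ℕ) ≤ j) :
    homotopyArgs i I σ (Function.update a j x) = homotopyArgs i I σ a := by
  funext k
  unfold homotopyArgs
  split_ifs with h
  · rw [Function.update_of_ne]
    intro e
    have := congrArg Fin.val e
    have h' : (k : ℕ) < i := h
    simp only at this
    omega
  · rfl
  · rfl

theorem homotopyTail_update_of_lt {n : ℕ} (i : Fin (n + 1)) (a : Fin n → Abar N) (j : Fin n)
    (x : Abar N) (hj : (j : ℕ) < i) :
    homotopyTail i (Function.update a j x) = homotopyTail i a := by
  funext k
  unfold homotopyTail
  rw [Function.update_of_ne]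
  intro e
  have := congrArg Fin.val e
  simp only at this
  omega

theorem homotopyTail_update_of_le {n : ℕ} (i : Fin (n + 1)) (a : Fin n → Abar N) (j : Fin n)
    (x : Abar N) (hj : (i : ℕ) ≤ j) :
    homotopyTail i (Function.update a j x) =
      Function.update (homotopyTail i a) ⟨j - i, by omega⟩ x := by
  funext k
  by_cases hk : k = ⟨j - i, by omega⟩
  · subst hk
    have : (⟨i + (j - i), by omega⟩ : Fin n) = j := Fin.ext (by simp; omega)
    simp [homotopyTail, this]
  · rw [Function.update_of_ne hk]
    unfold homotopyTail
    rw [Function.update_of_ne]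
    intro e
    have := congrArg Fin.val e
    simp only at this
    exact hk (Fin.ext (by simp; omega))

theorem toLinearMap_update_add {m : ℕ} (φ : Cochain S m) {j i : Fin m} (h : j ≠ i)
    (v : Fin m → Abar N) (x y : Abar N) :
    φ.toLinearMap (Function.update v j (x + y)) i =
      φ.toLinearMap (Function.update v j x) i + φ.toLinearMap (Function.update v j y) i := by
  refine LinearMap.ext fun u => ?_
  simp only [MultilinearMap.toLinearMap_apply, LinearMap.add_apply, Function.update_comm h,
    MultilinearMap.map_update_add]

theorem toLinearMap_update_smul {m : ℕ} (φ : Cochain S m) {j i : Fin m} (h : j ≠ i)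
    (v : Fin m → Abar N) (c : ℂ) (x : Abar N) :
    φ.toLinearMap (Function.update v j (c • x)) i =
      c • φ.toLinearMap (Function.update v j x) i := by
  refine LinearMap.ext fun u => ?_
  simp only [MultilinearMap.toLinearMap_apply, LinearMap.smul_apply, Function.update_comm h,
    MultilinearMap.map_update_smul]

/-- The multilinear map sending `(a₁, …, a_n)` to
`∑ φ(a₁ ⊗ ⋯ ⊗ a_i ⊗ u ⊗ x_{i_{σ(1)}} ⊗ ⋯ ⊗ x_{i_{σ(n-i)}}) v`, where `∑ u ⊗ v` is the coefficient
of `e^{i₁} ⋯ e^{i_{n-i}}` in `Υ(1 ⊗ a_{i+1} ⊗ ⋯ ⊗ a_n ⊗ 1)`. -/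
def homotopyTerm {n : ℕ} (i : Fin (n + 1)) (I : Fin (n - i) ↪o Fin N)
    (σ : Equiv.Perm (Fin (n - i))) (φ : Cochain S (n + 1)) : Cochain S n :=
  MultilinearMap.mk'
    (fun a => contract (φ.toLinearMap (homotopyArgs i I σ a) i ∘ₗ toAbar)
      (upsilonCoeff I (homotopyTail i a)))
    (fun a j x y => by
      rcases lt_or_ge (j : ℕ) i with hj | hj
      · have hne : j.castSucc ≠ i := fun e => absurd (congrArg Fin.val e) (ne_of_lt hj)
        simp only [homotopyArgs_update_of_lt i I σ a j _ hj, homotopyTail_update_of_lt i a j _ hj,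
          toLinearMap_update_add φ hne, LinearMap.add_comp, map_add, LinearMap.add_apply]
      · simp only [homotopyArgs_update_of_le i I σ a j _ hj, homotopyTail_update_of_le i a j _ hj,
          MultilinearMap.map_update_add, map_add])
    (fun a j c x => by
      rcases lt_or_ge (j : ℕ) i with hj | hj
      · have hne : j.castSucc ≠ i := fun e => absurd (congrArg Fin.val e) (ne_of_lt hj)
        simp only [homotopyArgs_update_of_lt i I σ a j _ hj, homotopyTail_update_of_lt i a j _ hj,
          toLinearMap_update_smul φ hne, LinearMap.smul_comp, map_smul, LinearMap.smul_apply]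
      · simp only [homotopyArgs_update_of_le i I σ a j _ hj, homotopyTail_update_of_le i a j _ hj,
          MultilinearMap.map_update_smul, map_smul])

theorem homotopyTerm_apply {n : ℕ} (i : Fin (n + 1)) (I : Fin (n - i) ↪o Fin N)
    (σ : Equiv.Perm (Fin (n - i))) (φ : Cochain S (n + 1)) (a : Fin n → Abar N) :
    homotopyTerm i I σ φ a =
      contract (φ.toLinearMap (homotopyArgs i I σ a) i ∘ₗ toAbar)
        (upsilonCoeff I (homotopyTail i a)) := rfl

theorem homotopyTerm_add {n : ℕ} (i : Fin (n + 1)) (I : Fin (n - i) ↪o Fin N)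
    (σ : Equiv.Perm (Fin (n - i))) (φ ψ : Cochain S (n + 1)) :
    homotopyTerm i I σ (φ + ψ) = homotopyTerm i I σ φ + homotopyTerm i I σ ψ := by
  refine MultilinearMap.ext fun a => ?_
  have h : (φ + ψ).toLinearMap (homotopyArgs i I σ a) i =
      φ.toLinearMap (homotopyArgs i I σ a) i + ψ.toLinearMap (homotopyArgs i I σ a) i := rfl
  simp only [homotopyTerm_apply, add_apply, h, LinearMap.add_comp,
    map_add, LinearMap.add_apply]

theorem homotopyTerm_smul {n : ℕ} (i : Fin (n + 1)) (I : Fin (n - i) ↪o Fin N)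
    (σ : Equiv.Perm (Fin (n - i))) (c : ℂ) (φ : Cochain S (n + 1)) :
    homotopyTerm i I σ (c • φ) = c • homotopyTerm i I σ φ := by
  refine MultilinearMap.ext fun a => ?_
  have h : (c • φ).toLinearMap (homotopyArgs i I σ a) i =
      c • φ.toLinearMap (homotopyArgs i I σ a) i := rfl
  simp only [homotopyTerm_apply, smul_apply, h, LinearMap.smul_comp,
    map_smul, LinearMap.smul_apply]

/-- The map `H^* : C^{n+1}(Ā, A[S]) → C^n(Ā, A[S])` induced by the homotopy
`H(a₀ ⊗ ⋯ ⊗ a_{n+1}) = ∑_{i=1}^{n+1} (-1)^i a₀ ⊗ ⋯ ⊗ a_{i-1} ⊗ ΦΥ(1 ⊗ a_i ⊗ ⋯ ⊗ a_{n+1})` of the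
bar resolution, where `Φ(e^{i₁} ⋯ e^{i_m} u ⊗ v) = ∑_σ sgn(σ) u ⊗ x_{i_{σ(1)}} ⊗ ⋯ ⊗ v`. The index
`i` of the code is one less than the index `i` of this formula. -/
def hStar {n : ℕ} : Cochain S (n + 1) →ₗ[ℂ] Cochain S n where
  toFun φ := ∑ i : Fin (n + 1), (-1 : ℂ) ^ ((i : ℕ) + 1) •
    ∑ I : Fin (n - i) ↪o Fin N, ∑ σ : Equiv.Perm (Fin (n - i)),
      ((Equiv.Perm.sign σ : ℤ) : ℂ) • homotopyTerm i I σ φ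
  map_add' φ ψ := by
    simp only [homotopyTerm_add, smul_add, Finset.sum_add_distrib]
  map_smul' c φ := by
    simp only [homotopyTerm_smul, RingHom.id_apply, Finset.smul_sum]
    refine Finset.sum_congr rfl fun i _ => Finset.sum_congr rfl fun I _ =>
      Finset.sum_congr rfl fun σ _ => ?_
    simp only [smul_smul]
    congr 1
    ring

/-! ### Compact type complexes and the perturbed retraction -/

/-- Compact type reduced cochains `⨁_p C^p(Ā, A[S])`. -/
abbrev CochainC (S : Subgroup (Torus N)) : Type := ⨁ p : ℕ, Cochain S p

/-- The Koszul complex `⨁_p K^p(A, A[S])`. -/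
abbrev KoszulC (S : Subgroup (Torus N)) : Type := ⨁ p : ℕ, Koszul S p

/-- Extension of maps `C^{n+1} → C^n` to `⨁_p C^p`, by zero on `C^0`. -/
def lowerTotal (f : ∀ n : ℕ, Cochain S (n + 1) →ₗ[ℂ] Cochain S n) :
    CochainC S →ₗ[ℂ] CochainC S :=
  DirectSum.toModule ℂ ℕ _ fun p => match p with
    | 0 => 0
    | n + 1 => DirectSum.lof ℂ ℕ (fun p => Cochain S p) n ∘ₗ f n

/-- `d_W H^*` on `⨁_p C^p`. -/
def dWH (W : Poly N) : CochainC S →ₗ[ℂ] CochainC S :=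
  lowerTotal (fun _ => dW W) ∘ₗ lowerTotal (fun _ => hStar)

theorem lowerTotal_lof_zero (f : ∀ n : ℕ, Cochain S (n + 1) →ₗ[ℂ] Cochain S n) (c : Cochain S 0) :
    lowerTotal f (DirectSum.lof ℂ ℕ (fun p => Cochain S p) 0 c) = 0 := by
  simp [lowerTotal]

theorem lowerTotal_lof_succ (f : ∀ n : ℕ, Cochain S (n + 1) →ₗ[ℂ] Cochain S n) (n : ℕ)
    (c : Cochain S (n + 1)) :
    lowerTotal f (DirectSum.lof ℂ ℕ (fun p => Cochain S p) (n + 1) c) =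
      DirectSum.lof ℂ ℕ (fun p => Cochain S p) n (f n c) := by
  simp [lowerTotal]

/-- `d_W H^*` is locally nilpotent, so the Neumann series below is a finite sum. -/
theorem dWH_locally_nilpotent (W : Poly N) (x : CochainC S) :
    ∃ m₀, ∀ m, m₀ ≤ m → (dWH W ^ m) x = 0 := by
  induction x using DirectSum.induction_on with
  | zero => exact ⟨0, fun m _ => map_zero _⟩
  | add x y hx hy =>
    obtain ⟨a, ha⟩ := hx
    obtain ⟨b, hb⟩ := hy
    refine ⟨max a b, fun m hm => ?_⟩
    rw [map_add, ha m (le_trans (le_max_left _ _) hm), hb m (le_trans (le_max_right _ _) hm),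
      add_zero]
  | of p c =>
    have key : ∀ m p (c : Cochain S p), p < m →
        (dWH W ^ m) (DirectSum.lof ℂ ℕ (fun p => Cochain S p) p c) = 0 := by
      intro m
      induction m with
      | zero => intro p c h; omega
      | succ m ih =>
        intro p c h
        rw [pow_succ, Module.End.mul_apply]
        match p, c, h with
        | 0, c, h => simp [dWH, lowerTotal_lof_zero]
        | 1, c, h => simp [dWH, lowerTotal_lof_succ, lowerTotal_lof_zero]
        | p + 2, c, h =>
          rw [dWH, LinearMap.comp_apply, lowerTotal_lof_succ, lowerTotal_lof_succ]
          exact ih p _ (by omega)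
    exact ⟨p + 1, fun m hm => key m p c hm⟩

/-- `(id + d_W H^*)^{-1} = ∑_{m ≥ 0} (-1)^m (d_W H^*)^m`. -/
def neumann (W : Poly N) (x : CochainC S) : CochainC S :=
  ∑ᶠ m : ℕ, (-1 : ℂ) ^ m • (dWH W ^ m) x

/-- `Φ^*` on `⨁_p C^p`. -/
def phiStarC : CochainC S →ₗ[ℂ] KoszulC S := DirectSum.lmap fun _ => phiStar

/-- The perturbed retraction `Φ̃^* = Φ^* - Φ^* (id + d_W H^*)^{-1} d_W H^*`. -/
def phiTilde (W : Poly N) (x : CochainC S) : KoszulC S :=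
  phiStarC x - phiStarC (neumann W (dWH W x))

/-- The Jacobian ring `Jac(W) = A / (∂W/∂x₁, …, ∂W/∂x_N)`. -/
abbrev Jac (W : Poly N) : Type :=
  Poly N ⧸ Ideal.span (Set.range fun i : Fin N => MvPolynomial.pderiv i W)

/-- The projection `p` in the identity sector: the class in `Jac(W)` of the coefficient in
`A = A e` of the polyvector degree zero part. -/
def projJac (W : Poly N) (κ : KoszulC S) : Jac W :=
  Ideal.Quotient.mk _ ((κ 0 (Fin.castLEOrderEmb (Nat.zero_le N))).coeff 1)

/-! ### Quantum differential operators -/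

/-- The operator `∂_{x_i}^g` on `A`: it sends `x^γ` to `[γ_i]_λ x^{γ - e_i}`, where `ᵍx_i = λ x_i`
and `[n]_λ = 1 + λ + ⋯ + λ^{n-1}`, and to `0` if `γ_i = 0`. -/
def qDiff (g : Torus N) (i : Fin N) : Poly N →ₗ[ℂ] Poly N :=
  (MvPolynomial.basisMonomials (Fin N) ℂ).constr ℂ fun γ =>
    MvPolynomial.monomial (γ - Finsupp.single i 1) (∑ s ∈ Finset.range (γ i), (g i : ℂ) ^ s)

theorem qDiff_one (g : Torus N) (i : Fin N) : qDiff g i (1 : Poly N) = 0 := by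
  have h : (1 : Poly N) = MvPolynomial.basisMonomials (Fin N) ℂ 0 := by simp
  rw [h, qDiff, Module.Basis.constr_basis]; simp

/-- The `1`-cochain `a ↦ f(a) t` given by a linear map `f : Ā → A` and `t ∈ S`. -/
def oneCochain (f : Abar N →ₗ[ℂ] Poly N) (t : S) : Cochain S 1 :=
  MultilinearMap.ofSubsingleton ℂ (Abar N) (Crossed S) (0 : Fin 1)
    (SkewMonoidAlgebra.lsingle ℂ t ∘ₗ f)

/-- The operator `∂_{x_i}^g` as a map on `Ā`. -/
def qDiffBar (g : Torus N) (i : Fin N) : Abar N →ₗ[ℂ] Poly N := descend (qDiff g i) (qDiff_one g i)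

variable {G : Subgroup (Torus N)}

/-- The first order quantum differential operator
`∂_i^g : a ↦ ∂_{x_i}^g(a) g^{(i)}`, in `C^1(Ā, A[G̃])`. -/
def firstOrder (g : G) (i : Fin N) : Cochain (tildeGroup G) 1 :=
  oneCochain (qDiffBar (g : Torus N) i) (tildeComponent g i)

/-- The second order quantum differential operator `∂_{i,j}^{g,h}` in `C^1(Ā, A[G̃])`. For `i ≠ j`
it is the twisted brace `∂_i^g{∂_j^h} : a ↦ ∂_{x_i}^g(∂_{x_j}^h(a)) g^{(i)} h^{(j)}`, and for
`i = j` it is `-H^*(∂_i^g ∪ ∂_i^h)`. -/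
def secondOrder (g h : G) (i j : Fin N) : Cochain (tildeGroup G) 1 :=
  if i = j then -hStar (cup (firstOrder g i) (firstOrder h i))
  else oneCochain (qDiff (g : Torus N) i ∘ₗ qDiffBar (h : Torus N) j)
    (tildeComponent g i * tildeComponent h j)

/-- `∏_{l ∈ s} g^{(l)}` as an element of `C^0(Ā, A[G̃]) = A[G̃]`. -/
def groupFactor (g : G) (s : Finset (Fin N)) : Crossed (tildeGroup G) :=
  SkewMonoidAlgebra.single (∏ l ∈ s, tildeComponent g l) 1

/-- The factor `g^{(j, i-1)} ∂_{i,j}^{g,g⁻¹}(W) (g⁻¹)^{(j+1, i)}` of `A[G̃]`. -/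
def edgeFactor (W : Poly N) (g : G) (i j : Fin N) : Crossed (tildeGroup G) :=
  groupFactor g (Finset.Ico j i) * secondOrder g g⁻¹ i j (fun _ => toAbar W) *
    groupFactor g⁻¹ (Finset.Ioc j i)

/-- The signed sum over the permutations `σ` with `j_{σ(k)} ≤ i_k` for all `k`, in `A[G̃]`. -/
def graphSum (W : Poly N) (g : G) {p : ℕ} (i j : Fin p ↪o Fin N) : Crossed (tildeGroup G) :=
  (-1 : ℂ) ^ (p * (p - 1) / 2) •
    ∑ σ ∈ Finset.univ.filter (fun σ : Equiv.Perm (Fin p) => ∀ k, j (σ k) ≤ i k),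
      ((Equiv.Perm.sign σ : ℤ) : ℂ) • (List.ofFn fun k => edgeFactor W g (i k) (j (σ k))).prod

/-- The cup product `Υ^*(e_{i₁} ⋯ e_{i_p} g) ∪ Υ^*(e_{j₁} ⋯ e_{j_q} g⁻¹)`. -/
def sectorCup (g : G) {p q : ℕ} (i : Fin p ↪o Fin N) (j : Fin q ↪o Fin N) : CochainC G :=
  DirectSum.lof ℂ ℕ (fun n => Cochain G n) (p + q)
    (cup (upsilonStar (koszulGen i g)) (upsilonStar (koszulGen j g⁻¹)))

end OrbifoldLG

end

noncomputable section

namespace OrbifoldLG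

variable {N : ℕ} {S G : Subgroup (Torus N)}

/-! ### Splittings of letters -/

/-! In degree zero `Φ^*` is evaluation on the empty word, and `Φ^* - Φ^*(1 + T)⁻¹T = Φ^*(1 + T)⁻¹`
for `T = d_W H^*`. So everything comes down to evaluating `T^m φ` on the empty word. Dually, `T`
acts on words: `d_W` inserts `W` somewhere, then `H^*` replaces a tail by a letter `u` followed by
permuted variables `x_I`, with a factor `v` on the right, where `u ⊗ v` runs through `D_I` of the
tail.

Write `D_l W = ∑ u_e ⊗ v_e`, where `u_e` involves only the variables from `x_l` on; `l` is the label
of `u_e`. Since `I` increases, `D_I` kills any word in which such a `u` precedes a variable of at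
most the same label. The invariant `IsWord` is built on this. Only tails consisting of variables and
the inserted `W` survive, and a tail without `W` gives `u = 1`, which is zero in `Ā`. Hence each
step adds one `u` to the right of all earlier ones (`homotopyTerm_eq_zero_of_forall`). The same
cancellation shows that `φ` is nonzero on such a word only if `p = q` and the letters `u` fill the
first `p` places (`IsWord.eq_range_of_cup_ne_zero`). This proves (1).

For (2), a gap between the letters `u` is never filled later, so only the words `u₁ ⋯ u_t x_{f(1)} ⋯
x_{f(t)}` matter. On their alternating sums over the variables, the insertion of `W` among the
variables is a signed shuffle (`sum_shuffle`), and `T` becomes the recursion `altEval_dW_hStar`: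
append `u_e`, put its label in front of `f`, multiply by `v_e`, change the sign. The signs cancel
those of the Neumann series, and undoing the reversed order of the labels costs `(-1)^{p(p-1)/2}`.
What remains is a signed sum over permutations of products of the polynomials `edgePoly`, which
vanish for `i < j` and otherwise are the factors of the stated sum (`edgeFactor_eq_single`). -/

theorem split_monomial (i : Fin N) (γ : Fin N →₀ ℕ) (c : ℂ) :
    split i (MvPolynomial.monomial γ c) =
      ∑ s ∈ Finset.range (γ i),
        MvPolynomial.monomial (Finsupp.single i (γ i - 1 - s) + γ.filter (i < ·)) c ⊗ₜ[ℂ]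
          MvPolynomial.monomial (γ.filter (· < i) + Finsupp.single i s) (1 : ℂ) := by
  have h : MvPolynomial.monomial γ c = c • MvPolynomial.basisMonomials (Fin N) ℂ γ := by
    simp [MvPolynomial.smul_monomial]
  rw [h, map_smul, split, Module.Basis.constr_basis, Finset.smul_sum]
  refine Finset.sum_congr rfl fun s _ => ?_
  rw [TensorProduct.smul_tmul', MvPolynomial.smul_monomial, smul_eq_mul, mul_one]

theorem splitBar_toAbar (i : Fin N) (a : Poly N) : splitBar i (toAbar a) = split i a := rfl

theorem splitBar_X (i l : Fin N) :
    splitBar i (toAbar (MvPolynomial.X l : Poly N)) = if i = l then 1 else 0 := by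
  rw [splitBar_toAbar, MvPolynomial.X, split_monomial]
  split_ifs with h
  · subst h
    have h1 : (Finsupp.single i 1 : Fin N →₀ ℕ).filter (i < ·) = 0 := by
      ext k
      rw [Finsupp.filter_apply]
      split_ifs with hk
      · simp [hk.ne]
      · rfl
    have h2 : (Finsupp.single i 1 : Fin N →₀ ℕ).filter (· < i) = 0 := by
      ext k
      rw [Finsupp.filter_apply]
      split_ifs with hk
      · simp [hk.ne']
      · rfl
    simp [h1, h2, Algebra.TensorProduct.one_def]
  · simp [Ne.symm h]

/-- A decomposition of the splittings of `W` into pure tensors `u e ⊗ v e`, indexed by `E`, where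
`u e` involves only the variables from the index `lab e` on. -/
structure Splitting (W : Poly N) (E : Type) [Fintype E] where
  lab : E → Fin N
  u : E → Poly N
  v : E → Poly N
  split_u : ∀ e i, i < lab e → split i (u e) = 0
  split_W : ∀ l, split l W = ∑ e, if lab e = l then u e ⊗ₜ[ℂ] v e else 0

theorem split_monomial_of_lt {i l : Fin N} (h : i < l) (n : ℕ) (γ : Fin N →₀ ℕ) (c : ℂ) :
    split i (MvPolynomial.monomial (Finsupp.single l n + γ.filter (l < ·)) c) = 0 := by
  rw [split_monomial]
  have h1 : (Finsupp.single l n + γ.filter (l < ·)) i = 0 := by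
    simp [h.le, h.ne']
  simp [h1]

/-- The decomposition of the splittings of `W` into monomials. -/
def monomialSplitting (W : Poly N) :
    Splitting W ((l : Fin N) × (γ : W.support) × Fin (γ.1 l)) where
  lab e := e.1
  u e := MvPolynomial.monomial
    (Finsupp.single e.1 (e.2.1.1 e.1 - 1 - e.2.2) + e.2.1.1.filter (e.1 < ·)) (W.coeff e.2.1.1)
  v e := MvPolynomial.monomial (e.2.1.1.filter (· < e.1) + Finsupp.single e.1 (e.2.2 : ℕ)) 1
  split_u e i h := split_monomial_of_lt h _ _ _
  split_W l := by
    rw [Fintype.sum_sigma, Finset.sum_eq_single l]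
    · simp only [if_true]
      rw [Fintype.sum_sigma]
      conv_lhs => rw [W.as_sum]
      rw [map_sum, ← Finset.sum_coe_sort]
      refine Finset.sum_congr rfl fun γ _ => ?_
      rw [split_monomial, Finset.sum_range]
    · intro l' _ h
      simp [h]
    · simp

/-! ### Words -/

/-- A word whose letters at the positions in `U` are killed by the splittings at the indices below
their label, and whose other letters are the variables given by the labels; every variable has an
earlier letter in `U` of at least the same label, every letter in `U` has a later variable of at
most the same label, and half of the letters are in `U`. -/
structure IsWord {n : ℕ} (U : Finset ℕ) (ℓ : Fin n → Fin N) (a : Fin n → Abar N) : Prop where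
  subset : ∀ k ∈ U, k < n
  eq_var : ∀ k : Fin n, (k : ℕ) ∉ U → a k = toAbar (MvPolynomial.X (ℓ k))
  split_eq_zero : ∀ k : Fin n, (k : ℕ) ∈ U → ∀ i < ℓ k, splitBar i (a k) = 0
  exists_before : ∀ k : Fin n, (k : ℕ) ∉ U → ∃ m : Fin n, (m : ℕ) ∈ U ∧ m < k ∧ ℓ k ≤ ℓ m
  exists_after : ∀ m : Fin n, (m : ℕ) ∈ U → ∃ k : Fin n, (k : ℕ) ∉ U ∧ m < k ∧ ℓ k ≤ ℓ m
  card : 2 * U.card = n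

/-- The second factor forces `j = ℓ k ≤ ℓ m`, so `i < ℓ m` and the first factor vanishes. This is
the cancellation behind all the vanishing statements below. -/
theorem IsWord.splitBar_mul_splitBar {n : ℕ} {U : Finset ℕ} {ℓ : Fin n → Fin N}
    {a : Fin n → Abar N} (h : IsWord U ℓ a) {m k : Fin n} (hm : (m : ℕ) ∈ U) (hk : (k : ℕ) ∉ U)
    (hℓ : ℓ k ≤ ℓ m) {i j : Fin N} (hij : i < j) :
    splitBar i (a m) * splitBar j (a k) = 0 := by
  rw [h.eq_var k hk, splitBar_X]
  split_ifs with e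
  · rw [h.split_eq_zero m hm i (lt_of_lt_of_le hij (e ▸ hℓ)), zero_mul]
  · rw [mul_zero]

theorem prod_eq_zero_of_mul_eq_zero {ι R : Type*} [Fintype ι] [CommSemiring R]
    (f : ι → R) {i j : ι} (hij : i ≠ j) (h : f i * f j = 0) : ∏ k, f k = 0 := by
  classical
  rw [← Finset.mul_prod_erase _ _ (Finset.mem_univ i),
    ← Finset.mul_prod_erase _ _ (Finset.mem_erase.2 ⟨hij.symm, Finset.mem_univ j⟩), ← mul_assoc, h,
    zero_mul]

theorem upsilonCoeff_apply {p : ℕ} (I : Fin p ↪o Fin N) (a : Fin p → Abar N) :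
    upsilonCoeff I a = ∏ k, splitBar (I k) (a k) := by
  simp [upsilonCoeff]

theorem splitBar_prod_eq_zero_or_one {n : ℕ} (I : Fin n → Fin N) (f : Fin n → Fin N)
    (a : Fin n → Abar N) (ha : ∀ k, a k = toAbar (MvPolynomial.X (f k))) :
    ∏ k, splitBar (I k) (a k) = if I = f then 1 else 0 := by
  simp_rw [ha, splitBar_X, Finset.prod_ite_zero, Finset.prod_const_one]
  simp [funext_iff]

/-! ### The homotopy on words -/

theorem val_le_val_succAbove {n : ℕ} (s : Fin (n + 1)) (k : Fin n) :
    (k : ℕ) ≤ s.succAbove k := by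
  rw [Fin.succAbove]
  split_ifs <;> simp

/-- One step of the recursion on words. If the tail from position `i` on contains a letter of `U`,
it also contains a later variable of at most the same label, and `D_I` kills it. If it misses `W`,
then `D_I` is `0` or `1 ⊗ 1`, and `1` vanishes in `Ā`. Otherwise the tail consists of `W` and
variables, and `χ` is evaluated on words with `i` added to `U`. -/
theorem homotopyTerm_eq_zero_of_forall {W : Poly N} {E : Type} [Fintype E] (D : Splitting W E)
    {n : ℕ} (χ : Cochain S (n + 2)) {U : Finset ℕ} {ℓ : Fin n → Fin N} {a : Fin n → Abar N}
    (ha : IsWord U ℓ a) (s : Fin (n + 1)) (i : Fin (n + 2)) (I : Fin (n + 1 - i) ↪o Fin N)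
    (σ : Equiv.Perm (Fin (n + 1 - i)))
    (hχ : (∀ k ∈ U, k < (i : ℕ)) → (i : ℕ) ≤ s → ∀ (ℓ' : Fin (n + 2) → Fin N)
      (a' : Fin (n + 2) → Abar N), IsWord (insert (i : ℕ) U) ℓ' a' → χ a' = 0) :
    homotopyTerm i I σ χ (s.insertNth (toAbar W) a) = 0 := by
  have hins : ∀ k : Fin n, s.insertNth (α := fun _ => Abar N) (toAbar W) a (s.succAbove k) = a k :=
    fun k => by simp
  rw [homotopyTerm_apply]
  by_cases hU : ∃ u : Fin n, (u : ℕ) ∈ U ∧ (i : ℕ) ≤ s.succAbove u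
  · obtain ⟨u, hu, hiu⟩ := hU
    obtain ⟨k, hk, huk, hℓ⟩ := ha.exists_after u hu
    have huk' : s.succAbove u < s.succAbove k := Fin.strictMono_succAbove s huk
    have h1 : (s.succAbove u : ℕ) < n + 1 := (s.succAbove u).2
    have h2 : (s.succAbove k : ℕ) < n + 1 := (s.succAbove k).2
    have huk'' : (s.succAbove u : ℕ) < s.succAbove k := huk'
    have e : upsilonCoeff I (homotopyTail i (s.insertNth (toAbar W) a)) = 0 := by
      rw [upsilonCoeff_apply]
      refine prod_eq_zero_of_mul_eq_zero _ (i := ⟨s.succAbove u - i, by omega⟩)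
        (j := ⟨s.succAbove k - i, by omega⟩) (by simp only [ne_eq, Fin.mk.injEq]; omega) ?_
      have e1 : homotopyTail i (s.insertNth (α := fun _ => Abar N) (toAbar W) a)
          ⟨s.succAbove u - i, by omega⟩ = a u := by
        rw [← hins u]; unfold homotopyTail; congr 1; ext; simp only; omega
      have e2 : homotopyTail i (s.insertNth (α := fun _ => Abar N) (toAbar W) a)
          ⟨s.succAbove k - i, by omega⟩ = a k := by
        rw [← hins k]; unfold homotopyTail; congr 1; ext; simp only; omega
      rw [e1, e2]
      refine ha.splitBar_mul_splitBar hu hk hℓ (I.strictMono ?_)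
      rw [Fin.lt_def]; simp only; omega
    rw [e, map_zero]
  push Not at hU
  by_cases hsi : (s : ℕ) < i
  · have key : ∀ k : Fin (n + 1 - i), ∃ f : Fin N,
        homotopyTail i (s.insertNth (α := fun _ => Abar N) (toAbar W) a) k =
          toAbar (MvPolynomial.X f) := by
      intro k
      have hne : (⟨i + k, by omega⟩ : Fin (n + 1)) ≠ s := by
        intro e
        have := congrArg Fin.val e
        simp only at this
        omega
      obtain ⟨m, hm⟩ := Fin.exists_succAbove_eq hne
      refine ⟨ℓ m, ?_⟩
      have hmU : (m : ℕ) ∉ U := by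
        intro h
        have := hU m h
        rw [hm] at this
        simp only at this
        omega
      rw [← ha.eq_var m hmU, ← hins m]
      unfold homotopyTail
      rw [hm]
    choose f hf using key
    rw [upsilonCoeff_apply, splitBar_prod_eq_zero_or_one I f _ hf]
    split_ifs
    · have h1 : (toAbar (1 : Poly N)) = 0 := by
        rw [toAbar, Submodule.mkQ_apply, Submodule.Quotient.mk_eq_zero]
        exact Submodule.mem_span_singleton_self 1
      rw [Algebra.TensorProduct.one_def, contract_tmul, LinearMap.comp_apply, h1, map_zero,
        zero_mul]
    · rw [map_zero]
  push Not at hsi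
  have hUi : ∀ k ∈ U, k < (i : ℕ) := by
    intro k hk
    have := hU ⟨k, ha.subset k hk⟩ hk
    by_contra hki
    push Not at hki
    have h1 : k ≤ (s.succAbove ⟨k, ha.subset k hk⟩ : ℕ) :=
      val_le_val_succAbove s ⟨k, ha.subset k hk⟩
    omega
  have hs : (s : ℕ) < n + 1 := s.2
  -- The position of `W` inside the tail.
  set s' : Fin (n + 1 - i) := ⟨s - i, by omega⟩ with hs'
  have hpos : ∀ k : Fin (n + 1 - i), k ≠ s' → ∃ m : Fin n, (s.succAbove m : ℕ) = i + k ∧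
      (m : ℕ) ∉ U ∧ homotopyTail i (s.insertNth (α := fun _ => Abar N) (toAbar W) a) k =
          toAbar (MvPolynomial.X (ℓ m)) := by
    intro k hk
    have hne : (⟨i + k, by omega⟩ : Fin (n + 1)) ≠ s := by
      intro e
      have := congrArg Fin.val e
      simp only at this
      refine hk (Fin.ext ?_)
      simp only [hs']
      omega
    obtain ⟨m, hm⟩ := Fin.exists_succAbove_eq hne
    have hmU : (m : ℕ) ∉ U := by
      intro h
      have := hU m h
      rw [hm] at this
      simp only at this
      omega
    refine ⟨m, by rw [hm], hmU, ?_⟩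
    rw [← ha.eq_var m hmU, ← hins m]
    unfold homotopyTail
    rw [hm]
  by_cases hI : ∀ k : Fin (n + 1 - i), k ≠ s' → ∀ m : Fin n, (s.succAbove m : ℕ) = i + k →
      I k = ℓ m
  swap
  · push Not at hI
    obtain ⟨k, hk, m, hm, hne⟩ := hI
    obtain ⟨m', hm', -, hX⟩ := hpos k hk
    have hmm : m' = m := s.succAbove_right_injective (Fin.ext (by rw [hm, hm']))
    subst hmm
    rw [upsilonCoeff_apply, Finset.prod_eq_zero (Finset.mem_univ k), map_zero]
    rw [hX, splitBar_X, if_neg hne]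
  have hprod : upsilonCoeff I (homotopyTail i (s.insertNth (toAbar W) a)) = split (I s') W := by
    rw [upsilonCoeff_apply, Finset.prod_eq_single s']
    · have : homotopyTail i (s.insertNth (α := fun _ => Abar N) (toAbar W) a) s' = toAbar W := by
        have : (⟨i + s', by simp only [hs']; omega⟩ : Fin (n + 1)) = s := by
          ext; simp only [hs']; omega
        unfold homotopyTail
        rw [this]; simp
      rw [this, splitBar_toAbar]
    · intro k _ hk
      obtain ⟨m, hm, -, hX⟩ := hpos k hk
      rw [hX, splitBar_X, if_pos (hI k hk m hm)]
    · simp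
  rw [hprod, D.split_W, map_sum]
  refine Finset.sum_eq_zero fun e _ => ?_
  split_ifs with he
  swap
  · rw [map_zero]
  rw [contract_tmul, LinearMap.comp_apply, MultilinearMap.toLinearMap_apply]
  have hin : (i : ℕ) ≤ n := by omega
  -- The labels of the new word: the old ones before `i`, the index at which `W` was split for the
  -- new letter `u`, and the permuted indices of `I` after it.
  rw [hχ hUi hsi (fun k => if h : (k : ℕ) < i then ℓ ⟨k, by omega⟩ else
    if h' : (i : ℕ) < k then I (σ ⟨k - i - 1, by omega⟩) else I s'), zero_mul]
  have hℓlt : ∀ k : Fin (n + 2), ∀ h : (k : ℕ) < i, ∀ m : Fin n, (m : ℕ) = k →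
      ℓ ⟨k, by omega⟩ = ℓ m := fun k h m hm => congrArg ℓ (Fin.ext hm.symm)
  have hbefore : ∀ m : Fin n, (m : ℕ) < i → (s.succAbove m : ℕ) = m := by
    intro m hm
    rw [Fin.succAbove_of_castSucc_lt]
    · rfl
    · rw [Fin.lt_def]; simp only [Fin.val_castSucc]; omega
  refine ⟨?_, ?_, ?_, ?_, ?_, ?_⟩
  · intro k hk
    rcases Finset.mem_insert.1 hk with rfl | hk
    · omega
    · have := ha.subset k hk
      omega
  · intro k hk
    rw [Finset.mem_insert, not_or] at hk
    have hki : k ≠ i := fun h => hk.1 (congrArg Fin.val h)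
    rw [Function.update_of_ne hki]
    unfold homotopyArgs
    by_cases h : (k : ℕ) < i
    · have h' : k < i := h
      have hm := ha.eq_var ⟨k, by omega⟩ hk.2
      rw [dif_pos h, dif_pos h', ← hm, ← hins]
      congr 1
      exact Fin.ext (hbefore ⟨k, by omega⟩ h).symm
    · have h1 : (i : ℕ) < k := by have := Fin.val_ne_of_ne hki; omega
      have h' : ¬ k < i := h
      have h2 : i < k := h1
      rw [dif_neg h, dif_neg h', dif_pos h1, dif_pos h2]
  · intro k hk j hj
    rw [Finset.mem_insert] at hk
    by_cases hki : k = i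
    · subst hki
      rw [Function.update_self, splitBar_toAbar]
      simp only [lt_irrefl, dite_false] at hj
      exact D.split_u e j (he ▸ hj)
    · have hk' : (k : ℕ) ∈ U := hk.resolve_left fun h => hki (Fin.ext h)
      have h := hUi k hk'
      have h' : k < i := h
      rw [dif_pos h] at hj
      rw [Function.update_of_ne hki]
      unfold homotopyArgs
      rw [dif_pos h']
      have hm := ha.split_eq_zero ⟨k, by omega⟩ hk' j hj
      rw [← hins] at hm
      convert hm using 3
      exact Fin.ext (hbefore ⟨k, by omega⟩ h).symm
  · intro k hk
    rw [Finset.mem_insert, not_or] at hk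
    by_cases h : (k : ℕ) < i
    · obtain ⟨m, hm, hmk, hℓ⟩ := ha.exists_before ⟨k, by omega⟩ hk.2
      have hmk' : (m : ℕ) < k := hmk
      refine ⟨⟨m, by omega⟩, Finset.mem_insert_of_mem hm, hmk, ?_⟩
      rw [dif_pos h, dif_pos (by simp only; omega)]
      exact hℓ
    · have h1 : (i : ℕ) < k := by omega
      rw [dif_neg h, dif_pos h1]
      -- The variable `x_{I s'}` is matched with the new letter at `i`; any other variable was
      -- already in the tail, and its old partner stands before `i`.
      by_cases hk' : σ ⟨k - i - 1, by omega⟩ = s'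
      · refine ⟨i, Finset.mem_insert_self _ _, h1, ?_⟩
        simp [hk']
      · obtain ⟨m, hm, hmU, -⟩ := hpos _ hk'
        obtain ⟨r, hr, -, hℓ⟩ := ha.exists_before m hmU
        have hri := hUi r hr
        refine ⟨⟨r, by omega⟩, Finset.mem_insert_of_mem hr, ?_, ?_⟩
        · rw [Fin.lt_def]; simp only; omega
        · rw [dif_pos (by simpa using hri), hI _ hk' m hm]
          exact hℓ
  · have hlater : ∀ j : Fin (n + 1 - i), ∃ k : Fin (n + 2), (k : ℕ) ∉ insert (i : ℕ) U ∧
        (i : ℕ) < k ∧ ∀ h : (i : ℕ) < k, I (σ ⟨k - i - 1, by omega⟩) = I j := by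
      intro j
      have hj := (σ.symm j).2
      refine ⟨⟨i + 1 + σ.symm j, by omega⟩, ?_, by simp only; omega, ?_⟩
      · simp only [Finset.mem_insert, not_or]
        refine ⟨by omega, fun h => ?_⟩
        have := hUi _ h
        omega
      · intro h
        have : (⟨(i + 1 + σ.symm j : ℕ) - i - 1, by omega⟩ : Fin (n + 1 - i)) = σ.symm j := by
          ext; simp only; omega
        simp only [this, Equiv.apply_symm_apply]
    intro m hm
    rw [Finset.mem_insert] at hm
    by_cases hmi : (m : ℕ) = i
    · obtain ⟨k, hkU, hik, hk⟩ := hlater s'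
      refine ⟨k, hkU, by rw [Fin.lt_def]; omega, ?_⟩
      rw [dif_neg (by omega), dif_pos hik, hk hik, dif_neg (by omega), dif_neg (by omega)]
    · have hmU := hm.resolve_left hmi
      have hmi' := hUi _ hmU
      obtain ⟨k, hkU, hmk, hℓ⟩ := ha.exists_after ⟨m, by omega⟩ hmU
      have hmk' : (m : ℕ) < k := hmk
      -- A partner before `i` is untouched; a partner in the tail reappears after `i` at a permuted
      -- place.
      by_cases hki : (k : ℕ) < i
      · refine ⟨⟨k, by omega⟩, ?_, hmk, ?_⟩
        · simp only [Finset.mem_insert, not_or]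
          exact ⟨by omega, hkU⟩
        · rw [dif_pos (by simpa using hki), dif_pos hmi']
          exact hℓ
      · have h2 : (k : ℕ) ≤ s.succAbove k := val_le_val_succAbove s k
        have h3 := (s.succAbove k).2
        have hne : (⟨s.succAbove k - i, by omega⟩ : Fin (n + 1 - i)) ≠ s' := by
          intro h
          have h4 : (s.succAbove k : ℕ) = s := by
            have := congrArg Fin.val h
            simp only [hs'] at this
            omega
          exact Fin.succAbove_ne s k (Fin.ext h4)
        obtain ⟨k', hkU', hik', hk'⟩ := hlater ⟨s.succAbove k - i, by omega⟩
        refine ⟨k', hkU', by rw [Fin.lt_def]; omega, ?_⟩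
        rw [dif_neg (by omega), dif_pos hik', hk' hik', dif_pos hmi',
          hI _ hne k (by simp only; omega)]
        exact hℓ
  · have : (i : ℕ) ∉ U := fun h => lt_irrefl _ (hUi _ h)
    rw [Finset.card_insert_of_notMem this]
    have := ha.card
    omega

theorem hStar_apply {n : ℕ} (φ : Cochain S (n + 1)) (a : Fin n → Abar N) :
    hStar φ a = ∑ i : Fin (n + 1), (-1 : ℂ) ^ ((i : ℕ) + 1) •
      ∑ I : Fin (n - i) ↪o Fin N, ∑ σ : Equiv.Perm (Fin (n - i)),
        ((Equiv.Perm.sign σ : ℤ) : ℂ) • homotopyTerm i I σ φ a := by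
  simp [hStar]

/-- A cochain vanishes on the words whose set `U` has the property `Q`. -/
def VanishesOn (Q : Finset ℕ → Prop) {n : ℕ} (φ : Cochain S n) : Prop :=
  ∀ (U : Finset ℕ) (ℓ : Fin n → Fin N) (a : Fin n → Abar N), IsWord U ℓ a → Q U → φ a = 0

/-- A step only adds to `U` a position beyond all the others, so a property stable under such
insertions passes from `χ` to the next cochain. -/
theorem VanishesOn.dW_hStar (W : Poly N) {Q : Finset ℕ → Prop}
    (hQ : ∀ U r, (∀ k ∈ U, k < r) → Q U → Q (insert r U)) {n : ℕ} {χ : Cochain S (n + 2)}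
    (hχ : VanishesOn Q χ) : VanishesOn Q (dW W (hStar χ)) := by
  intro U ℓ a ha hU
  rw [dW_apply]
  refine Finset.sum_eq_zero fun s _ => ?_
  rw [hStar_apply, Finset.sum_eq_zero, smul_zero]
  intro i _
  rw [Finset.sum_eq_zero, smul_zero]
  intro I _
  refine Finset.sum_eq_zero fun σ _ => ?_
  rw [homotopyTerm_eq_zero_of_forall (monomialSplitting W) χ ha s i I σ, smul_zero]
  exact fun h _ ℓ' a' ha' => hχ _ ℓ' a' ha' (hQ U i h hU)

theorem dWH_component (W : Poly N) (x : CochainC S) (n : ℕ) :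
    dWH W x n = dW W (hStar (x (n + 2))) := by
  induction x using DirectSum.induction_on with
  | zero => simp
  | add x y hx hy => rw [map_add, DirectSum.add_apply, hx, hy, DirectSum.add_apply, map_add, map_add]
  | of p c =>
    change dWH W (DirectSum.lof ℂ ℕ (fun p => Cochain S p) p c) n =
      dW W (hStar (DirectSum.lof ℂ ℕ (fun p => Cochain S p) p c (n + 2)))
    match p, c with
    | 0, c =>
      rw [dWH, LinearMap.comp_apply, lowerTotal_lof_zero]
      simp [DirectSum.lof_eq_of, DirectSum.of_apply]
    | 1, c =>
      rw [dWH, LinearMap.comp_apply, lowerTotal_lof_succ, lowerTotal_lof_zero]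
      simp [DirectSum.lof_eq_of, DirectSum.of_apply]
    | p + 2, c =>
      rw [dWH, LinearMap.comp_apply, lowerTotal_lof_succ, lowerTotal_lof_succ]
      by_cases h : p = n
      · subst h
        rw [DirectSum.lof_apply, DirectSum.lof_apply]
      · rw [DirectSum.lof_eq_of, DirectSum.lof_eq_of, DirectSum.of_eq_of_ne _ _ _ (Ne.symm h),
          DirectSum.of_eq_of_ne _ _ _ (by omega), map_zero, map_zero]

theorem VanishesOn.dWH_pow (W : Poly N) {Q : Finset ℕ → Prop}
    (hQ : ∀ U r, (∀ k ∈ U, k < r) → Q U → Q (insert r U)) (m : ℕ) :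
    ∀ (n : ℕ) (x : CochainC S), VanishesOn Q (x (n + 2 * m)) → VanishesOn Q ((dWH W ^ m) x n) := by
  induction m with
  | zero => intro n x hx; exact hx
  | succ m ih =>
    intro n x hx
    rw [pow_succ', Module.End.mul_apply, dWH_component]
    refine VanishesOn.dW_hStar W hQ (ih (n + 2) x ?_)
    have : n + 2 + 2 * m = n + 2 * (m + 1) := by ring
    rw [this]
    exact hx

theorem isWord_empty (ℓ : Fin 0 → Fin N) (a : Fin 0 → Abar N) : IsWord ∅ ℓ a :=
  ⟨by simp, fun k => k.elim0, fun k => k.elim0, fun k => k.elim0, fun k => k.elim0, rfl⟩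

/-! ### The cup product on words -/

theorem upsilonStar_koszulGen {p : ℕ} (I : Fin p ↪o Fin N) (g : S) (a : Fin p → Abar N) :
    upsilonStar (koszulGen I g) a =
      contract (LinearMap.mulRight ℂ (SkewMonoidAlgebra.single g (1 : Poly N)) ∘ₗ inclA S)
        (∏ k, splitBar (I k) (a k)) := by
  classical
  rw [upsilonStar, sum_apply, Finset.sum_eq_single I]
  · simp [koszulGen, LinearMap.compMultilinearMap_apply, upsilonCoeff_apply]
  · intro J _ hJ
    have h : koszulGen I g J = 0 := by
      unfold koszulGen
      convert Pi.single_eq_of_ne hJ _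
    have h0 : LinearMap.mulRight ℂ (0 : Crossed S) = 0 := by ext x : 1; simp
    rw [h, h0, LinearMap.zero_comp, map_zero]
    rfl
  · simp

/-- A letter of `U` in the second block has a later variable in the same block, and a variable in
the first block has an earlier letter of `U` in that block. Either pair makes the splitting of its
block vanish. Counting the letters of `U` then gives `p = q`. -/
theorem IsWord.eq_range_of_cup_ne_zero {p q : ℕ} {I : Fin p ↪o Fin N} {J : Fin q ↪o Fin N}
    {g h : S} {U : Finset ℕ} {ℓ : Fin (p + q) → Fin N} {a : Fin (p + q) → Abar N}
    (ha : IsWord U ℓ a)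
    (hne : cup (upsilonStar (koszulGen I g)) (upsilonStar (koszulGen J h)) a ≠ 0) :
    p = q ∧ U = Finset.range p := by
  rw [cup_apply, upsilonStar_koszulGen, upsilonStar_koszulGen] at hne
  have hU : U = Finset.range p := by
    ext k
    rw [Finset.mem_range]
    constructor
    · intro hk
      by_contra hkp
      push Not at hkp
      obtain ⟨m, hm, hkm, hℓ⟩ := ha.exists_after ⟨k, ha.subset k hk⟩ hk
      have hkm' : k < (m : ℕ) := hkm
      have hk' := ha.subset k hk
      refine hne ?_
      rw [prod_eq_zero_of_mul_eq_zero (fun k : Fin q => splitBar (J k) (a (Fin.natAdd p k)))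
        (i := ⟨k - p, by omega⟩) (j := ⟨m - p, by omega⟩)
        (by simp only [ne_eq, Fin.mk.injEq]; omega), map_zero, mul_zero]
      have e1 : Fin.natAdd p (⟨k - p, by omega⟩ : Fin q) = ⟨k, hk'⟩ := by
        ext; simp only [Fin.natAdd_mk]; omega
      have e2 : Fin.natAdd p (⟨m - p, by omega⟩ : Fin q) = m := by
        ext; simp only [Fin.natAdd_mk]; omega
      rw [e1, e2]
      refine ha.splitBar_mul_splitBar hk hm hℓ (J.strictMono ?_)
      rw [Fin.lt_def]; simp only; omega
    · intro hkp
      by_contra hk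
      obtain ⟨m, hm, hmk, hℓ⟩ := ha.exists_before ⟨k, by omega⟩ hk
      have hmk' : (m : ℕ) < k := hmk
      refine hne ?_
      rw [prod_eq_zero_of_mul_eq_zero (fun k : Fin p => splitBar (I k) (a (Fin.castAdd q k)))
        (i := ⟨m, by omega⟩) (j := ⟨k, hkp⟩)
        (by simp only [ne_eq, Fin.mk.injEq]; omega), map_zero, zero_mul]
      exact ha.splitBar_mul_splitBar hm hk hℓ (I.strictMono hmk)
  refine ⟨?_, hU⟩
  have := ha.card
  rw [hU, Finset.card_range] at this
  omega

theorem sectorCup_vanishesOn {Q : Finset ℕ → Prop} (g : G) {p q : ℕ}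
    (I : Fin p ↪o Fin N) (J : Fin q ↪o Fin N)
    (hQ : p = q → ¬ Q (Finset.range p)) (n : ℕ) : VanishesOn Q (sectorCup g I J n) := by
  intro U ℓ a ha hU
  by_cases hn : p + q = n
  · subst hn
    rw [sectorCup, DirectSum.lof_apply]
    by_contra hne
    obtain ⟨h1, h2⟩ := ha.eq_range_of_cup_ne_zero hne
    exact hQ h1 (h2 ▸ hU)
  · rw [sectorCup, DirectSum.lof_eq_of, DirectSum.of_eq_of_ne _ _ _ (Ne.symm hn)]
    rfl

/-! ### The perturbed retraction in degree zero -/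

theorem phiStarC_component_zero (x : CochainC S) (I : Fin 0 ↪o Fin N) :
    phiStarC x 0 I = x 0 Fin.elim0 := by
  rw [phiStarC, DirectSum.lmap_apply]
  simp only [phiStar, LinearMap.coe_mk, AddHom.coe_mk]
  rw [Fintype.sum_unique]
  rw [Subsingleton.elim (default : Equiv.Perm (Fin 0)) 1, Equiv.Perm.sign_one, Units.val_one,
    Int.cast_one, one_smul]
  congr 1
  exact Subsingleton.elim _ _

/-- The two terms of `Φ̃^*` combine into `Φ^*(1 + T)⁻¹` with `T = d_W H^*`, and `Φ^*` in degree zero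
evaluates on the empty word. -/
theorem phiTilde_eq_sum (W : Poly N) (x : CochainC S) (M : ℕ)
    (hM : ∀ m, M ≤ m → (dWH W ^ m) x = 0) (I : Fin 0 ↪o Fin N) :
    phiTilde W x 0 I = ∑ m ∈ Finset.range (M + 1),
      (-1 : ℂ) ^ m • (dWH W ^ m) x 0 Fin.elim0 := by
  have h1 : neumann W (dWH W x) = ∑ m ∈ Finset.range M, (-1 : ℂ) ^ m • (dWH W ^ (m + 1)) x := by
    rw [neumann, finsum_eq_sum_of_support_subset (s := Finset.range M)]
    · rfl
    · intro m hm
      rw [Function.mem_support] at hm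
      by_contra hlt
      refine hm ?_
      have := hM (m + 1) (by simp at hlt; omega)
      rw [pow_succ, Module.End.mul_apply] at this
      rw [this, smul_zero]
  have h2 : phiTilde W x = phiStarC (∑ m ∈ Finset.range (M + 1), (-1 : ℂ) ^ m • (dWH W ^ m) x) := by
    rw [phiTilde, h1, sub_eq_iff_eq_add, ← map_add]
    congr 1
    rw [Finset.sum_range_succ', add_right_comm, ← Finset.sum_add_distrib, Finset.sum_eq_zero]
    · simp
    · intro m _
      rw [← add_smul, pow_succ, mul_neg_one, neg_add_cancel, zero_smul]
  rw [h2, phiStarC_component_zero, DFinsupp.finsetSum_apply, sum_apply]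
  rfl

/-- In the sectors of different degrees all the terms vanish. -/
theorem phiTilde_sectorCup_of_ne (W : Poly N) (g : G) {p q : ℕ}
    (hpq : p ≠ q) (I : Fin p ↪o Fin N) (J : Fin q ↪o Fin N) (I₀ : Fin 0 ↪o Fin N) :
    phiTilde W (sectorCup g I J) 0 I₀ = 0 := by
  obtain ⟨M, hM⟩ := dWH_locally_nilpotent W (sectorCup g I J)
  rw [phiTilde_eq_sum W _ M hM]
  refine Finset.sum_eq_zero fun m _ => ?_
  rw [VanishesOn.dWH_pow W (Q := fun _ => True) (fun _ _ _ _ => trivial) m 0 _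
    (sectorCup_vanishesOn g I J (fun h => absurd h hpq) _) ∅ Fin.elim0 Fin.elim0
    (isWord_empty _ _) trivial, smul_zero]

/-! ### Alternating sums over shuffles -/

/-- The permutation of `Fin (t + 1)` that moves `0` to the position `s` and permutes the rest by
`σ`. -/
def insertPerm {t : ℕ} (x : Equiv.Perm (Fin t) × Fin (t + 1)) : Equiv.Perm (Fin (t + 1)) :=
  Equiv.Perm.decomposeFin.symm (0, x.1) * x.2.cycleRange

theorem cons_comp_insertPerm {t : ℕ} {α : Type*} (l : α) (f : Fin t → α)
    (x : Equiv.Perm (Fin t) × Fin (t + 1)) :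
    (Fin.cons l f : Fin (t + 1) → α) ∘ insertPerm x =
      x.2.insertNth (α := fun _ => α) l (f ∘ x.1) := by
  rw [← Fin.cons_comp_cycleRange, insertPerm, Equiv.Perm.coe_mul, ← Function.comp_assoc]
  congr 1
  funext k
  refine Fin.cases ?_ (fun k => ?_) k <;> simp

theorem sign_insertPerm {t : ℕ} (x : Equiv.Perm (Fin t) × Fin (t + 1)) :
    Equiv.Perm.sign (insertPerm x) = Equiv.Perm.sign x.1 * (-1) ^ (x.2 : ℕ) := by
  simp [insertPerm]

theorem insertPerm_bijective (t : ℕ) : Function.Bijective (insertPerm (t := t)) := by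
  rw [Fintype.bijective_iff_injective_and_card]
  constructor
  · rintro ⟨σ, s⟩ ⟨τ, r⟩ h
    have h0 : s = r := by
      have h1 : insertPerm (σ, s) s = 0 := by simp [insertPerm]
      have h2 : insertPerm (τ, r) r = 0 := by simp [insertPerm]
      rw [h] at h1
      exact (insertPerm (τ, r)).injective (h1.trans h2.symm)
    subst h0
    rw [insertPerm, insertPerm, mul_left_inj] at h
    have := Equiv.Perm.decomposeFin.symm.injective h
    simp only [Prod.mk.injEq, true_and] at this
    rw [this]
  · simp [Fintype.card_perm, Nat.factorial_succ, mul_comm]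

/-- An injective tuple has exactly one increasing rearrangement. -/
theorem sum_perm_orderEmb_comp {m : ℕ} {M : Type*} [AddCommMonoid M] (h : Fin m → Fin N)
    (hh : Function.Injective h) (c : M) :
    ∑ ρ : Equiv.Perm (Fin m), ∑ L : Fin m ↪o Fin N, (if ⇑L = h ∘ ρ then c else 0) = c := by
  have hmono : StrictMono (h ∘ Tuple.sort h) :=
    (Tuple.monotone_sort h).strictMono_of_injective (hh.comp (Tuple.sort h).injective)
  rw [Finset.sum_eq_single (Tuple.sort h),
    Finset.sum_eq_single (OrderEmbedding.ofStrictMono _ hmono)]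
  · exact if_pos rfl
  · intro L _ hL
    rw [if_neg]
    intro e
    exact hL (DFunLike.coe_injective e)
  · simp
  · intro ρ _ hρ
    refine Finset.sum_eq_zero fun L _ => if_neg fun e => hρ ?_
    have h1 : Monotone (h ∘ ρ) := e ▸ L.monotone
    have h2 := Tuple.unique_monotone h1 (Tuple.monotone_sort h)
    ext k : 1
    exact hh (congrFun h2 k)
  · simp

theorem alternating_eq_zero {m : ℕ} {M : Type*} [AddCommGroup M] [Module ℂ M]
    (q : (Fin m → Fin N) → M)
    (hq : ∀ h (ρ : Equiv.Perm (Fin m)), q (h ∘ ρ) = ((Equiv.Perm.sign ρ : ℤ) : ℂ) • q h) {h : Fin m → Fin N}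
    (hh : ¬ Function.Injective h) : q h = 0 := by
  simp only [Function.Injective, not_forall] at hh
  obtain ⟨i, j, hij, hne⟩ := hh
  have e : h ∘ Equiv.swap i j = h := by
    funext k
    simp only [Function.comp_apply, Equiv.swap_apply_def]
    split_ifs with h1 h2
    · rw [h1, hij]
    · rw [h2, hij]
    · rfl
  have h1 := hq h (Equiv.swap i j)
  rw [e, Equiv.Perm.sign_swap hne] at h1
  simp only [Units.val_neg, Units.val_one, Int.cast_neg, Int.cast_one, neg_smul, one_smul] at h1
  have h2 : (2 : ℂ) • q h = 0 := by
    rw [two_smul]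
    nth_rewrite 2 [h1]
    rw [add_neg_cancel]
  exact (smul_eq_zero.1 h2).resolve_left two_ne_zero

/-- Pairs `(σ, s)` correspond to permutations of `t + 1` letters, with sign `sgn(σ)(-1)^s`. As `q`
is alternating, every nonzero term equals `q (Fin.cons l f)`. Exactly one term survives if the
indices are distinct; otherwise `q` vanishes. -/
theorem sum_shuffle {t : ℕ} {M : Type*} [AddCommGroup M] [Module ℂ M]
    (q : (Fin (t + 1) → Fin N) → M)
    (hq : ∀ h (ρ : Equiv.Perm (Fin (t + 1))), q (h ∘ ρ) = ((Equiv.Perm.sign ρ : ℤ) : ℂ) • q h)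
    (l : Fin N) (f : Fin t → Fin N) :
    ∑ σ : Equiv.Perm (Fin t), ∑ s : Fin (t + 1), ∑ L : Fin (t + 1) ↪o Fin N,
      (if ⇑L = s.insertNth (α := fun _ => Fin N) l (f ∘ σ) then
        (((Equiv.Perm.sign σ : ℤ) : ℂ) * (-1) ^ (s : ℕ)) • q L else 0) = q (Fin.cons l f) := by
  have key : ∀ x : Equiv.Perm (Fin t) × Fin (t + 1), ∀ L : Fin (t + 1) ↪o Fin N,
      (if ⇑L = x.2.insertNth (α := fun _ => Fin N) l (f ∘ x.1) then
        (((Equiv.Perm.sign x.1 : ℤ) : ℂ) * (-1) ^ (x.2 : ℕ)) • q L else 0) =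
      if ⇑L = (Fin.cons l f : Fin (t + 1) → Fin N) ∘ insertPerm x then q (Fin.cons l f) else 0 := by
    intro x L
    rw [cons_comp_insertPerm]
    split_ifs with h
    · have e : (((Equiv.Perm.sign x.1 : ℤ) : ℂ) * (-1) ^ (x.2 : ℕ)) =
          ((Equiv.Perm.sign (insertPerm x) : ℤ) : ℂ) := by
        rw [sign_insertPerm]; simp
      rw [h, ← cons_comp_insertPerm, hq, e, smul_smul, ← Int.cast_mul, ← Units.val_mul,
        Int.units_mul_self]
      simp
    · rfl
  rw [← Fintype.sum_prod_type' (f := fun (σ : Equiv.Perm (Fin t)) (s : Fin (t + 1)) => ∑ L : Fin (t + 1) ↪o Fin N,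
      (if ⇑L = s.insertNth (α := fun _ => Fin N) l (f ∘ σ) then
        (((Equiv.Perm.sign σ : ℤ) : ℂ) * (-1) ^ (s : ℕ)) • q L else 0))]
  simp_rw [key]
  rw [(insertPerm_bijective t).sum_comp (fun ρ => ∑ L : Fin (t + 1) ↪o Fin N,
    if ⇑L = (Fin.cons l f : Fin (t + 1) → Fin N) ∘ ρ then q (Fin.cons l f) else 0)]
  by_cases h : Function.Injective (Fin.cons l f : Fin (t + 1) → Fin N)
  · exact sum_perm_orderEmb_comp _ h _
  · rw [alternating_eq_zero q hq h]
    simp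

/-! ### Words with all the variables at the end -/

/-- The word `u₁, …, u_t, x_{f(1)}, …, x_{f(t)}`. -/
def goodWord {t : ℕ} (u : Fin t → Abar N) (f : Fin t → Fin N) : Fin (2 * t) → Abar N := fun k =>
  if h : (k : ℕ) < t then u ⟨k, h⟩ else toAbar (MvPolynomial.X (f ⟨k - t, by omega⟩))

theorem isWord_goodWord {W : Poly N} {E : Type} [Fintype E] (D : Splitting W E) {t : ℕ}
    (e : Fin t → E) (ρ : Equiv.Perm (Fin t)) :
    IsWord (Finset.range t)
      (fun k : Fin (2 * t) => if h : (k : ℕ) < t then D.lab (e ⟨k, h⟩)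
        else D.lab (e (ρ ⟨k - t, by omega⟩)))
      (goodWord (fun k => toAbar (D.u (e k))) (fun k => D.lab (e (ρ k)))) := by
  refine ⟨?_, ?_, ?_, ?_, ?_, ?_⟩
  · intro k hk
    rw [Finset.mem_range] at hk
    omega
  · intro k hk
    rw [Finset.mem_range] at hk
    rw [goodWord, dif_neg hk, dif_neg hk]
  · intro k hk i hi
    rw [Finset.mem_range] at hk
    rw [dif_pos hk] at hi
    rw [goodWord, dif_pos hk, splitBar_toAbar]
    exact D.split_u _ _ hi
  · intro k hk
    rw [Finset.mem_range] at hk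
    have h1 := (ρ ⟨k - t, by omega⟩).2
    refine ⟨⟨ρ ⟨k - t, by omega⟩, by omega⟩, by simp, by rw [Fin.lt_def]; simp only; omega, ?_⟩
    rw [dif_neg hk, dif_pos (by simp)]
  · intro k hk
    rw [Finset.mem_range] at hk
    have h1 := (ρ.symm ⟨k, hk⟩).2
    refine ⟨⟨t + ρ.symm ⟨k, hk⟩, by omega⟩, by simp, by rw [Fin.lt_def]; simp only; omega, ?_⟩
    rw [dif_pos hk, dif_neg (by simp)]
    simp
  · simp

/-- The alternating sum of the values of `ψ` on `u₁, …, u_t, x_{f(σ(1))}, …, x_{f(σ(t))}`. -/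
def altEval {t : ℕ} (ψ : Cochain S (2 * t)) (u : Fin t → Abar N) (f : Fin t → Fin N) : Crossed S :=
  ∑ σ : Equiv.Perm (Fin t), ((Equiv.Perm.sign σ : ℤ) : ℂ) • ψ (goodWord u (f ∘ σ))

theorem altEval_comp {t : ℕ} (ψ : Cochain S (2 * t)) (u : Fin t → Abar N) (f : Fin t → Fin N)
    (ρ : Equiv.Perm (Fin t)) :
    altEval ψ u (f ∘ ρ) = ((Equiv.Perm.sign ρ : ℤ) : ℂ) • altEval ψ u f := by
  rw [altEval, altEval, Finset.smul_sum, eq_comm, ← Equiv.sum_comp (Equiv.mulLeft ρ)]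
  refine Finset.sum_congr rfl fun σ _ => ?_
  rw [Equiv.coe_mulLeft, smul_smul, Equiv.Perm.sign_mul, Units.val_mul, Int.cast_mul, ← mul_assoc,
    ← Int.cast_mul, ← Units.val_mul, Int.units_mul_self, Equiv.Perm.coe_mul, Units.val_one,
    Int.cast_one, one_mul, Function.comp_assoc]

/-- Frees the length of the tail from the dependent type `Fin (n - i)`. -/
theorem homotopySum_cast {n m : ℕ} (i : Fin (n + 1)) (hm : n - i = m) (φ : Cochain S (n + 1))
    (b : Fin n → Abar N) :
    ∑ I : Fin (n - i) ↪o Fin N, ∑ σ : Equiv.Perm (Fin (n - i)),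
        ((Equiv.Perm.sign σ : ℤ) : ℂ) • homotopyTerm i I σ φ b =
      ∑ I : Fin m ↪o Fin N, ∑ σ : Equiv.Perm (Fin m), ((Equiv.Perm.sign σ : ℤ) : ℂ) •
        contract (φ.toLinearMap (fun k => if h : k < i then b ⟨k, by omega⟩
          else if h' : i < k then toAbar (MvPolynomial.X (I (σ ⟨k - i - 1, by omega⟩)))
          else 0) i ∘ₗ toAbar) (∏ k, splitBar (I k) (b ⟨i + k, by omega⟩)) := by
  subst hm
  simp_rw [homotopyTerm_apply, upsilonCoeff_apply]
  rfl

theorem insertNth_goodWord_tail {t : ℕ} (x : Abar N) (u : Fin t → Abar N) (f : Fin t → Fin N)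
    (s : Fin (t + 1)) (k : Fin (t + 1)) :
    (⟨t + s, by omega⟩ : Fin (2 * t + 1)).insertNth (α := fun _ => Abar N) x (goodWord u f)
        ⟨t + k, by omega⟩ =
      s.insertNth (α := fun _ => Abar N) x (fun j => toAbar (MvPolynomial.X (f j))) k := by
  refine Fin.succAboveCases s ?_ (fun j => ?_) k
  · rw [Fin.insertNth_apply_same, Fin.insertNth_apply_same]
  · have h : (⟨t + s.succAbove j, by omega⟩ : Fin (2 * t + 1)) =
        (⟨t + s, by omega⟩ : Fin (2 * t + 1)).succAbove ⟨t + j, by omega⟩ := by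
      ext
      simp only [Fin.succAbove, Fin.lt_def, Fin.val_castSucc]
      split_ifs <;> simp only [Fin.val_castSucc, Fin.val_succ] at * <;> omega
    rw [h, Fin.insertNth_apply_succAbove, Fin.insertNth_apply_succAbove, goodWord,
      dif_neg (by simp)]
    simp

theorem insertNth_goodWord_head {t : ℕ} (x : Abar N) (u : Fin t → Abar N) (f : Fin t → Fin N)
    (s : Fin (t + 1)) (k : Fin t) :
    (⟨t + s, by omega⟩ : Fin (2 * t + 1)).insertNth (α := fun _ => Abar N) x (goodWord u f)
        ⟨k, by omega⟩ = u k := by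
  have h : (⟨k, by omega⟩ : Fin (2 * t + 1)) =
      (⟨t + s, by omega⟩ : Fin (2 * t + 1)).succAbove ⟨k, by omega⟩ := by
    ext
    simp only [Fin.succAbove, Fin.lt_def, Fin.val_castSucc]
    rw [if_pos (by omega)]
    rfl
  rw [h, Fin.insertNth_apply_succAbove, goodWord, dif_pos k.2]

/-- The variables are dual to the indices, so they fix `L` away from `s` and only the splitting of
`W` remains. -/
theorem prod_splitBar_insertNth {t : ℕ} (W : Poly N) (f : Fin t → Fin N) (s : Fin (t + 1))
    (L : Fin (t + 1) → Fin N) :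
    ∏ k, splitBar (L k) (s.insertNth (α := fun _ => Abar N) (toAbar W)
        (fun j => toAbar (MvPolynomial.X (f j))) k) =
      if L ∘ s.succAbove = f then split (L s) W else 0 := by
  rw [Fin.prod_univ_succAbove _ s, Fin.insertNth_apply_same, splitBar_toAbar]
  simp_rw [Fin.insertNth_apply_succAbove]
  rw [splitBar_prod_eq_zero_or_one (fun j => L (s.succAbove j)) f _ fun k => rfl]
  simp only [Function.comp_def]
  split_ifs <;> simp

/-- The surviving term: `W` stands at place `s` among the variables, and the whole block of
variables together with `W` is the tail. The sum over `σ` in `H^*` is exactly the alternating sum of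
the next word. -/
theorem homotopySum_goodWord {W : Poly N} {E : Type} [Fintype E] (D : Splitting W E) {t : ℕ}
    (χ : Cochain S (2 * (t + 1))) (u : Fin t → Abar N) (f : Fin t → Fin N) (s : Fin (t + 1))
    (i : Fin (2 * t + 2)) (hi : (i : ℕ) = t) :
    ∑ I : Fin (2 * t + 1 - i) ↪o Fin N, ∑ σ : Equiv.Perm (Fin (2 * t + 1 - i)),
        ((Equiv.Perm.sign σ : ℤ) : ℂ) • homotopyTerm i I σ χ
          ((⟨t + s, by omega⟩ : Fin (2 * t + 1)).insertNth (toAbar W) (goodWord u f)) =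
      ∑ e, ∑ L : Fin (t + 1) ↪o Fin N,
        (if ⇑L = s.insertNth (α := fun _ => Fin N) (D.lab e) f then
          altEval χ (Fin.snoc (α := fun _ => Abar N) u (toAbar (D.u e))) L else 0) *
            inclA S (D.v e) := by
  obtain ⟨i, hi'⟩ := i
  simp only at hi
  subst hi
  rw [homotopySum_cast (m := i + 1) _ (by simp only; omega)]
  rw [Finset.sum_comm (s := (Finset.univ : Finset E))]
  refine Finset.sum_congr rfl fun L _ => ?_
  have hcond : ∀ e, (⇑L = s.insertNth (α := fun _ => Fin N) (D.lab e) f) ↔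
      (D.lab e = L s ∧ L ∘ s.succAbove = f) := fun e => by
    rw [Fin.eq_insertNth_iff, eq_comm]
    exact and_congr_right fun _ => Iff.rfl
  simp_rw [insertNth_goodWord_tail, prod_splitBar_insertNth, hcond]
  by_cases hL : ⇑L ∘ s.succAbove = f
  swap
  · simp [hL]
  simp_rw [if_pos hL, D.split_W, map_sum, Finset.smul_sum]
  rw [Finset.sum_comm]
  refine Finset.sum_congr rfl fun e _ => ?_
  by_cases he : D.lab e = L s
  swap
  · simp [he]
  rw [if_pos (show D.lab e = L s ∧ ⇑L ∘ s.succAbove = f from ⟨he, hL⟩), altEval, Finset.sum_mul]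
  refine Finset.sum_congr rfl fun σ _ => ?_
  rw [if_pos he, contract_tmul, smul_mul_assoc, LinearMap.comp_apply,
    MultilinearMap.toLinearMap_apply]
  congr 3
  funext k
  by_cases hk : (k : ℕ) = i
  · obtain rfl : k = ⟨i, hi'⟩ := Fin.ext hk
    rw [Function.update_self, goodWord, dif_pos (by simp)]
    exact (Fin.snoc_last (α := fun _ => Abar N) _ _).symm
  · rw [Function.update_of_ne fun h => hk (congrArg Fin.val h)]
    by_cases hlt : (k : ℕ) < i
    · rw [dif_pos (by rwa [Fin.lt_def]), goodWord, dif_pos (by omega)]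
      have h1 := insertNth_goodWord_head (toAbar W) u f s ⟨k, hlt⟩
      rw [h1]
      exact (Fin.snoc_castSucc (α := fun _ => Abar N) _ _ (⟨k, hlt⟩ : Fin i)).symm
    · rw [dif_neg (by rwa [Fin.lt_def]), dif_pos (by rw [Fin.lt_def]; simp only; omega), goodWord,
        dif_neg (by omega)]
      congr 5

/-! ### The recursion on words with all the variables at the end -/

/-- Some position outside of `U` precedes a position in `U`. -/
def HasGap (U : Finset ℕ) : Prop := ∃ k ∉ U, ∃ m ∈ U, k < m

theorem HasGap.insert {U : Finset ℕ} {r : ℕ} (hr : ∀ k ∈ U, k < r) (hU : HasGap U) :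
    HasGap (insert r U) := by
  obtain ⟨k, hk, m, hm, hkm⟩ := hU
  refine ⟨k, ?_, m, Finset.mem_insert_of_mem hm, hkm⟩
  rw [Finset.mem_insert, not_or]
  exact ⟨(hkm.trans (hr m hm)).ne, hk⟩

theorem not_hasGap_range (p : ℕ) : ¬ HasGap (Finset.range p) := by
  rintro ⟨k, hk, m, hm, hkm⟩
  rw [Finset.mem_range] at hk hm
  omega

/-- Only `i = t` with `W` inserted at or after position `t` contributes: a new letter beyond `t`
would leave position `t` as a gap. The sign is `(-1)^{t+s}` from `d_W` times `(-1)^{t+1}` from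
`H^*`. -/
theorem dW_hStar_goodWord {W : Poly N} {E : Type} [Fintype E] (D : Splitting W E) {t : ℕ}
    (χ : Cochain S (2 * (t + 1))) (hχ : VanishesOn HasGap χ) (e : Fin t → E)
    (ρ : Equiv.Perm (Fin t)) :
    dW W (hStar (n := 2 * t + 1) χ)
        (goodWord (fun k => toAbar (D.u (e k))) (fun k => D.lab (e (ρ k)))) =
      ∑ s : Fin (t + 1), ((-1 : ℂ) ^ (t + s : ℕ) * (-1) ^ (t + 1)) •
        ∑ e', ∑ L : Fin (t + 1) ↪o Fin N,
          (if ⇑L = s.insertNth (α := fun _ => Fin N) (D.lab e') (fun k => D.lab (e (ρ k))) then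
            altEval χ (Fin.snoc (α := fun _ => Abar N) (fun k => toAbar (D.u (e k)))
              (toAbar (D.u e'))) L else 0) * inclA S (D.v e') := by
  have hw := isWord_goodWord D e ρ
  have hzero : ∀ (s : Fin (2 * t + 1)) (i : Fin (2 * t + 2)), ¬ ((i : ℕ) = t ∧ t ≤ s) →
      ∑ I : Fin (2 * t + 1 - i) ↪o Fin N, ∑ σ : Equiv.Perm (Fin (2 * t + 1 - i)),
        ((Equiv.Perm.sign σ : ℤ) : ℂ) • homotopyTerm i I σ χ (s.insertNth (toAbar W)
          (goodWord (fun k => toAbar (D.u (e k))) (fun k => D.lab (e (ρ k))))) = 0 := by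
    intro s i hi
    refine Finset.sum_eq_zero fun I _ => Finset.sum_eq_zero fun σ _ => ?_
    rw [homotopyTerm_eq_zero_of_forall D χ hw s i I σ, smul_zero]
    intro h1 h2 ℓ' a' ha'
    refine hχ _ ℓ' a' ha' ?_
    have h3 : t ≤ (i : ℕ) := by
      by_contra h
      push Not at h
      exact lt_irrefl _ (h1 i (Finset.mem_range.2 h))
    refine ⟨t, ?_, i, Finset.mem_insert_self _ _, ?_⟩
    · simp only [Finset.mem_insert, Finset.mem_range, lt_irrefl, or_false]
      omega
    · omega
  rw [dW_apply, eq_comm]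
  refine Fintype.sum_of_injective (fun s : Fin (t + 1) => (⟨t + s, by omega⟩ : Fin (2 * t + 1)))
    (fun s r h => by simpa [Fin.ext_iff] using h) _ _ ?_ ?_
  · intro s hs
    rw [hStar_apply, Finset.sum_eq_zero, smul_zero]
    intro i _
    rw [hzero s i, smul_zero]
    rintro ⟨-, h⟩
    exact hs ⟨⟨s - t, by omega⟩, Fin.ext (by simp only; omega)⟩
  · intro s
    rw [hStar_apply, Finset.sum_eq_single (⟨t, by omega⟩ : Fin (2 * t + 2)),
      homotopySum_goodWord D χ _ _ s _ rfl, smul_smul]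
    · intro i _ hi
      rw [hzero _ i, smul_zero]
      rintro ⟨h, -⟩
      exact hi (Fin.ext h)
    · simp

theorem altEval_dW_hStar {W : Poly N} {E : Type} [Fintype E] (D : Splitting W E) {t : ℕ}
    (χ : Cochain S (2 * (t + 1))) (hχ : VanishesOn HasGap χ) (e : Fin t → E)
    (ρ : Equiv.Perm (Fin t)) :
    altEval (dW W (hStar (n := 2 * t + 1) χ))
        (fun k => toAbar (D.u (e k))) (fun k => D.lab (e (ρ k))) =
      (-1 : ℂ) • ∑ e', altEval χ (Fin.snoc (α := fun _ => Abar N) (fun k => toAbar (D.u (e k)))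
        (toAbar (D.u e'))) (Fin.cons (D.lab e') (fun k => D.lab (e (ρ k)))) *
          inclA S (D.v e') := by
  have h : ∀ σ : Equiv.Perm (Fin t), ((fun k => D.lab (e (ρ k))) ∘ σ : Fin t → Fin N) =
    fun k => D.lab (e ((ρ * σ) k)) := fun σ => rfl
  rw [altEval]
  simp_rw [h, dW_hStar_goodWord D χ hχ e (ρ * _)]
  simp_rw [← h, ← sum_shuffle _ (altEval_comp χ _)]
  simp_rw [Finset.smul_sum, Finset.sum_mul, Finset.smul_sum]
  rw [Finset.sum_comm (s := (Finset.univ : Finset E))]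
  refine Finset.sum_congr rfl fun σ _ => ?_
  rw [Finset.sum_comm (s := (Finset.univ : Finset E))]
  refine Finset.sum_congr rfl fun s _ => Finset.sum_congr rfl fun e' _ =>
    Finset.sum_congr rfl fun L _ => ?_
  split_ifs
  · rw [smul_mul_assoc, smul_smul, smul_smul]
    congr 1
    -- The two signs multiply to `-(-1)^s`; the factor `(-1)^s` is the shuffle sign.
    have h2 : (-1 : ℂ) ^ (t * 2) = 1 := by rw [mul_comm, pow_mul]; simp
    ring_nf
    rw [h2]
    ring
  · simp

/-- The sum of the alternating evaluations of `ψ` over all the words of length `2 t` that the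
recursion produces from the empty word. -/
def totalEval {W : Poly N} {E : Type} [Fintype E] (D : Splitting W E) {t : ℕ}
    (ψ : Cochain S (2 * t)) : Crossed S :=
  ∑ e : Fin t → E, altEval ψ (fun k => toAbar (D.u (e k))) (fun k => D.lab (e k.rev)) *
    inclA S (∏ k, D.v (e k))

theorem inclA_mul (a b : Poly N) : inclA S (a * b) = inclA S a * inclA S b := by
  change SkewMonoidAlgebra.single 1 (a * b) =
    SkewMonoidAlgebra.single 1 a * SkewMonoidAlgebra.single 1 b
  rw [SkewMonoidAlgebra.single_mul_single, one_mul, one_smul]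

/-- The new letter `u` goes to the end while its label goes to the front of the variables; this is
why `totalEval` reads the labels in reverse. -/
theorem totalEval_dW_hStar {W : Poly N} {E : Type} [Fintype E] (D : Splitting W E) {t : ℕ}
    (χ : Cochain S (2 * (t + 1))) (hχ : VanishesOn HasGap χ) :
    totalEval D (dW W (hStar (n := 2 * t + 1) χ)) = (-1 : ℂ) • totalEval D χ := by
  rw [totalEval, totalEval, ← (Fin.snocEquiv fun _ => E).sum_comp, Fintype.sum_prod_type,
    Finset.sum_comm, Finset.smul_sum]
  refine Finset.sum_congr rfl fun e _ => ?_
  have hstep := altEval_dW_hStar D χ hχ e Fin.revPerm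
  simp only [Fin.revPerm_apply] at hstep
  rw [hstep, smul_mul_assoc, Finset.sum_mul]
  refine congrArg (fun y => (-1 : ℂ) • y) ?_
  refine Finset.sum_congr rfl fun e' _ => ?_
  have h1 : (fun k : Fin (t + 1) => toAbar (D.u ((Fin.snocEquiv fun _ => E) (e', e) k))) =
      Fin.snoc (α := fun _ => Abar N) (fun k => toAbar (D.u (e k))) (toAbar (D.u e')) := by
    funext k
    refine Fin.lastCases ?_ (fun k => ?_) k <;> simp [Fin.snocEquiv]
  have h2 : (fun k : Fin (t + 1) => D.lab ((Fin.snocEquiv fun _ => E) (e', e) k.rev)) =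
      Fin.cons (D.lab e') (fun k => D.lab (e k.rev)) := by
    funext k
    refine Fin.cases ?_ (fun k => ?_) k <;> simp [Fin.snocEquiv, Fin.rev_succ]
  have h3 : ∏ k : Fin (t + 1), D.v ((Fin.snocEquiv fun _ => E) (e', e) k) =
      D.v e' * ∏ k, D.v (e k) := by
    rw [Fin.prod_univ_castSucc, mul_comm]
    simp [Fin.snocEquiv]
  rw [h1, h2, h3, inclA_mul, mul_assoc]

theorem dWH_pow_component {W : Poly N} {E : Type} [Fintype E] (D : Splitting W E) (m : ℕ) :
    ∀ (t : ℕ) (x : CochainC S), VanishesOn HasGap (x (2 * (t + m))) →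
      totalEval D ((dWH W ^ m) x (2 * t)) = (-1 : ℂ) ^ m • totalEval D (x (2 * (t + m))) := by
  induction m with
  | zero => intro t x _; simp
  | succ m ih =>
    intro t x hx
    have e : t + (m + 1) = t + 1 + m := by ring
    have hv : VanishesOn HasGap ((dWH W ^ m) x (2 * (t + 1))) := by
      refine VanishesOn.dWH_pow W (fun U r h hU => hU.insert h) m _ x ?_
      have : 2 * (t + 1) + 2 * m = 2 * (t + (m + 1)) := by ring
      rw [this]
      exact hx
    rw [e] at hx ⊢
    rw [pow_succ' (dWH W), Module.End.mul_apply, dWH_component]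
    refine (totalEval_dW_hStar D _ hv).trans ?_
    rw [ih (t + 1) x hx, smul_smul, pow_succ']

theorem inclA_one : inclA S (1 : Poly N) = 1 := rfl

theorem totalEval_zero {W : Poly N} {E : Type} [Fintype E] (D : Splitting W E)
    (ψ : Cochain S (2 * 0)) : totalEval D ψ = ψ Fin.elim0 := by
  have h : ∀ (u : Fin 0 → Abar N) (f : Fin 0 → Fin N), goodWord u f = Fin.elim0 :=
    fun _ _ => funext fun k => k.elim0
  rw [totalEval, Fintype.sum_unique, altEval, Fintype.sum_unique, h, Finset.univ_eq_empty,
    Finset.prod_empty, inclA_one, mul_one,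
    Subsingleton.elim (default : Equiv.Perm (Fin 0)) 1, Equiv.Perm.sign_one, Units.val_one,
    Int.cast_one, one_smul]

/-- The degree zero part of the perturbed retraction in terms of evaluations on words. -/
theorem phiTilde_sectorCup_eq_totalEval {W : Poly N} {E : Type} [Fintype E] (D : Splitting W E)
    (g : G) {p : ℕ} (I J : Fin p ↪o Fin N) (I₀ : Fin 0 ↪o Fin N) :
    phiTilde W (sectorCup g I J) 0 I₀ = totalEval D (sectorCup g I J (2 * p)) := by
  obtain ⟨M, hM⟩ := dWH_locally_nilpotent W (sectorCup g I J)
  have hv : ∀ n, VanishesOn HasGap (sectorCup g I J n) :=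
    sectorCup_vanishesOn g I J fun _ => not_hasGap_range p
  have hterm : ∀ m, (-1 : ℂ) ^ m • (dWH W ^ m) (sectorCup g I J) 0 Fin.elim0 =
      totalEval D (sectorCup g I J (2 * m)) := by
    intro m
    have h := dWH_pow_component D m 0 (sectorCup g I J) (hv _)
    rw [totalEval_zero, zero_add] at h
    refine (congrArg (fun y => (-1 : ℂ) ^ m • y) h).trans ?_
    rw [smul_smul, ← pow_add, ← two_mul, pow_mul]
    simp
  have hzero : ∀ m, m ≠ p → totalEval D (sectorCup g I J (2 * m)) = 0 := by
    intro m hm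
    have : sectorCup g I J (2 * m) = 0 := by
      rw [sectorCup, DirectSum.lof_eq_of, DirectSum.of_eq_of_ne _ _ _ (by omega)]
    rw [this]
    simp [totalEval, altEval]
  -- The bound must also exceed `p`, so that the only nonzero term lies in the range.
  rw [phiTilde_eq_sum W _ (max M p) (fun m hm => hM m (le_of_max_le_left hm))]
  simp_rw [hterm]
  rw [Finset.sum_eq_single p]
  · intro m _ hm
    exact hzero m hm
  · intro h
    refine absurd ?_ h
    rw [Finset.mem_range]
    omega

/-! ### The twisted multiplication -/

/-- The algebra homomorphism `A ⊗ A → A`, `a ⊗ b ↦ a ᵍb`. -/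
def twistMul (g : Torus N) : Poly N ⊗[ℂ] Poly N →ₐ[ℂ] Poly N :=
  Algebra.TensorProduct.lift (AlgHom.id ℂ (Poly N)) (torusAct g) fun _ _ => Commute.all _ _

theorem twistMul_tmul (g : Torus N) (a b : Poly N) :
    twistMul g (a ⊗ₜ[ℂ] b) = a * torusAct g b := by
  simp [twistMul]

theorem inclA_apply (a : Poly N) : inclA S a = SkewMonoidAlgebra.single 1 a := rfl

/-- Moving `g` past `v` in `u g v` gives `(u ᵍv) g`. -/
theorem contract_mulRight_single (g : S) (T : Poly N ⊗[ℂ] Poly N) :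
    contract (LinearMap.mulRight ℂ (SkewMonoidAlgebra.single g (1 : Poly N)) ∘ₗ inclA S) T =
      SkewMonoidAlgebra.single g (twistMul (g : Torus N) T) := by
  induction T using TensorProduct.induction_on with
  | zero => simp
  | add x y hx hy => rw [map_add, hx, hy, map_add, SkewMonoidAlgebra.single_add]
  | tmul a b =>
    rw [contract_tmul, twistMul_tmul, LinearMap.comp_apply, LinearMap.mulRight_apply, inclA_apply,
      inclA_apply, SkewMonoidAlgebra.single_mul_single, SkewMonoidAlgebra.single_mul_single,
      one_smul, one_mul, mul_one, mul_one]
    rfl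

theorem torusAct_monomial (g : Torus N) (β : Fin N →₀ ℕ) (c : ℂ) :
    torusAct g (MvPolynomial.monomial β c) =
      MvPolynomial.monomial β (c * ∏ k, (g k : ℂ) ^ β k) := by
  rw [torusAct, MvPolynomial.aeval_monomial, Finsupp.prod_fintype _ _ (by simp)]
  simp_rw [mul_pow, Finset.prod_mul_distrib]
  rw [MvPolynomial.monomial_eq (a := c * _), Finsupp.prod_fintype _ _ (by simp),
    MvPolynomial.algebraMap_eq, map_mul, map_prod]
  simp_rw [map_pow]
  ring

theorem twistMul_split_monomial (g : Torus N) (i : Fin N) (γ : Fin N →₀ ℕ) (c : ℂ) :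
    twistMul g (split i (MvPolynomial.monomial γ c)) =
      MvPolynomial.monomial (γ - Finsupp.single i 1)
        (c * (∑ r ∈ Finset.range (γ i), (g i : ℂ) ^ r) *
          ∏ k ∈ Finset.Iio i, (g k : ℂ) ^ γ k) := by
  rw [split_monomial, map_sum, Finset.mul_sum, Finset.sum_mul, map_sum]
  refine Finset.sum_congr rfl fun r hr => ?_
  rw [Finset.mem_range] at hr
  rw [twistMul_tmul, torusAct_monomial, MvPolynomial.monomial_mul]
  congr 1
  · congr 1
    ext k
    simp only [Finsupp.add_apply, Finsupp.tsub_apply, Finsupp.filter_apply, Finsupp.single_apply]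
    rcases lt_trichotomy i k with h | h | h
    · simp [h, h.ne, h.not_gt]
    · subst h
      simp
      omega
    · simp [h, h.ne', h.not_gt]
  · rw [one_mul, mul_assoc]
    congr 1
    have h1 : ∀ k, (g k : ℂ) ^ ((γ.filter (· < i) + Finsupp.single i r) k) =
        (if k = i then (g k : ℂ) ^ r else 1) * if k < i then (g k : ℂ) ^ γ k else 1 := by
      intro k
      simp only [Finsupp.add_apply, Finsupp.filter_apply, Finsupp.single_apply]
      rcases lt_trichotomy i k with h | h | h
      · simp [h.ne, h.ne', h.not_gt]
      · subst h
        simp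
      · simp [h, h.ne', h.ne]
    simp_rw [h1]
    rw [Finset.prod_mul_distrib, Finset.prod_ite_eq' Finset.univ i, if_pos (Finset.mem_univ _),
      ← Finset.prod_filter]
    congr 2
    ext k
    simp

/-! ### The edges of the graphs -/

/-- The linear map `u ⊗ v ↦ twistMul g (split i u) v`. -/
def edgeMap (g : Torus N) (i : Fin N) : Poly N ⊗[ℂ] Poly N →ₗ[ℂ] Poly N :=
  LinearMap.mul' ℂ (Poly N) ∘ₗ
    TensorProduct.map ((twistMul g).toLinearMap ∘ₗ split i) LinearMap.id

theorem edgeMap_tmul (g : Torus N) (i : Fin N) (u v : Poly N) :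
    edgeMap g i (u ⊗ₜ[ℂ] v) = twistMul g (split i u) * v := rfl

/-- The polynomial contributed by a pair of indices. -/
def edgePoly (W : Poly N) (g : Torus N) (i j : Fin N) : Poly N := edgeMap g i (split j W)

theorem edgePoly_eq_sum {W : Poly N} {E : Type} [Fintype E] (D : Splitting W E) (g : Torus N)
    (i j : Fin N) :
    edgePoly W g i j =
      ∑ e, if D.lab e = j then twistMul g (split i (D.u e)) * D.v e else 0 := by
  rw [edgePoly, D.split_W, map_sum]
  refine Finset.sum_congr rfl fun e _ => ?_
  split_ifs
  · rw [edgeMap_tmul]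
  · rw [map_zero]

/-- The first tensor factors of `D_j W` involve no variable before `x_j`, so `D_i` kills them. This
restricts the sum over all permutations to `V`. -/
theorem edgePoly_of_lt (W : Poly N) (g : Torus N) {i j : Fin N} (h : i < j) :
    edgePoly W g i j = 0 := by
  rw [edgePoly_eq_sum (monomialSplitting W)]
  refine Finset.sum_eq_zero fun e _ => ?_
  split_ifs with he
  · rw [(monomialSplitting W).split_u e i (he ▸ h), map_zero, zero_mul]
  · rfl

theorem qDiff_monomial (g : Torus N) (i : Fin N) (γ : Fin N →₀ ℕ) (c : ℂ) :
    qDiff g i (MvPolynomial.monomial γ c) = MvPolynomial.monomial (γ - Finsupp.single i 1)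
      (c * ∑ s ∈ Finset.range (γ i), (g i : ℂ) ^ s) := by
  have h : MvPolynomial.monomial γ c = c • MvPolynomial.basisMonomials (Fin N) ℂ γ := by
    simp [MvPolynomial.smul_monomial]
  rw [h, map_smul, qDiff, Module.Basis.constr_basis, MvPolynomial.smul_monomial, smul_eq_mul]

theorem coe_prod_tildeComponent (g : G) (s : Finset (Fin N)) (k : Fin N) :
    ((∏ l ∈ s, tildeComponent g l : tildeGroup G) : Torus N) k =
      if k ∈ s then (g : Torus N) k else 1 := by
  classical
  have h : ((∏ l ∈ s, tildeComponent g l : tildeGroup G) : Torus N) =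
      ∏ l ∈ s, component (g : Torus N) l := by
    rw [SubmonoidClass.coe_finsetProd]; rfl
  have h2 : (∏ l ∈ s, component (g : Torus N) l) k = ∏ l ∈ s, component (g : Torus N) l k :=
    Finset.prod_apply (M := fun _ => ℂˣ) k s _
  have h3 : ∀ l, component (g : Torus N) l k = if k = l then (g : Torus N) k else 1 := by
    intro l
    change (Pi.mulSingle l ((g : Torus N) l) : Fin N → ℂˣ) k = _
    rw [Pi.mulSingle_apply]
    split_ifs with e
    · rw [e]
    · rfl
  rw [h, h2]
  simp_rw [h3]
  rw [Finset.prod_ite_eq]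

theorem tildeComponent_inv (g : G) (i : Fin N) : tildeComponent g⁻¹ i = (tildeComponent g i)⁻¹ := by
  refine Subtype.ext ?_
  change (Pi.mulSingle i (((g : Torus N)⁻¹) i) : Fin N → ℂˣ) =
    (Pi.mulSingle i ((g : Torus N) i) : Fin N → ℂˣ)⁻¹
  rw [← Pi.mulSingle_inv]
  rfl

/-- The polynomial part of `g^{(j, i-1)} ∂_{i,j}^{g,g⁻¹}(W) (g⁻¹)^{(j+1, i)}` for `j < i`. -/
theorem smul_qDiff_qDiff_eq_edgePoly (W : Poly N) (g : G) {i j : Fin N} (h : j < i) :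
    (∏ l ∈ Finset.Ico j i, tildeComponent g l : tildeGroup G) •
      qDiff (g : Torus N) i (qDiff ((g⁻¹ : G) : Torus N) j W) = edgePoly W (g : Torus N) i j := by
  change torusAct _ _ = _
  rw [edgePoly]
  induction W using MvPolynomial.induction_on' with
  | add p q hp hq => simp only [map_add, hp, hq]
  | monomial γ c =>
    have hji : (γ - Finsupp.single j 1 : Fin N →₀ ℕ) i = γ i := by simp [h.ne]
    rw [qDiff_monomial, qDiff_monomial, torusAct_monomial, split_monomial, map_sum, hji]
    -- The quantum number at `i` is common to both sides. Only the one at `j` is expanded, to be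
    -- matched term by term with the splitting of `W` at `x_j`.
    generalize hB : ∑ r ∈ Finset.range (γ i), ((g : Torus N) i : ℂ) ^ r = B
    rw [Finset.mul_sum, Finset.sum_mul, Finset.sum_mul, map_sum]
    refine Finset.sum_congr rfl fun s hs => ?_
    rw [Finset.mem_range] at hs
    rw [edgeMap_tmul, twistMul_split_monomial, MvPolynomial.monomial_mul, mul_one]
    congr 1
    · congr 1
      ext k
      simp only [Finsupp.add_apply, Finsupp.tsub_apply, Finsupp.filter_apply, Finsupp.single_apply]
      rcases lt_trichotomy j k with h1 | h1 | h1
      · simp [h1, h1.ne, h1.not_gt]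
      · subst h1
        simp [h.ne']
        omega
      · simp [h1, h1.ne', (h1.trans h).ne', h1.not_gt]
    · have hα : (Finsupp.single j (γ j - 1 - s) + γ.filter (j < ·)) i = γ i := by
        simp [h, h.ne]
      have hsub : Finset.Ico j i ⊆ Finset.Iio i := fun k hk =>
        Finset.mem_Iio.2 (Finset.mem_Ico.1 hk).2
      have hne : ((g : Torus N) j : ℂ) ≠ 0 := Units.ne_zero _
      have hinv : (((g⁻¹ : G) : Torus N) j : ℂ) = ((g : Torus N) j : ℂ)⁻¹ :=
        Units.val_inv_eq_inv_val _
      have hprod : ∀ f : Fin N → ℂ, ∏ k ∈ Finset.Ico j i, f k = f j * ∏ k ∈ Finset.Ioo j i, f k :=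
        fun f => by rw [← Finset.Ioo_insert_left h, Finset.prod_insert Finset.left_notMem_Ioo]
      have hL : ∏ k, ((((∏ l ∈ Finset.Ico j i, tildeComponent g l : tildeGroup G) : Torus N) k :
          ℂˣ) : ℂ) ^ (γ - Finsupp.single j 1 - Finsupp.single i 1 : Fin N →₀ ℕ) k =
          ((g : Torus N) j : ℂ) ^ (γ j - 1) *
            ∏ k ∈ Finset.Ioo j i, ((g : Torus N) k : ℂ) ^ γ k := by
        have h1 : ∀ k, ((((∏ l ∈ Finset.Ico j i, tildeComponent g l : tildeGroup G) : Torus N) k :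
            ℂˣ) : ℂ) ^ (γ - Finsupp.single j 1 - Finsupp.single i 1 : Fin N →₀ ℕ) k =
            if k ∈ Finset.Ico j i then ((g : Torus N) k : ℂ) ^
              (γ - Finsupp.single j 1 - Finsupp.single i 1 : Fin N →₀ ℕ) k else 1 := by
          intro k
          rw [coe_prod_tildeComponent]
          split_ifs <;> simp
        simp_rw [h1]
        rw [Finset.prod_ite_mem, Finset.univ_inter, hprod]
        congr 1
        · simp [h.ne']
        · refine Finset.prod_congr rfl fun k hk => ?_
          rw [Finset.mem_Ioo] at hk
          simp [hk.1.ne, hk.2.ne']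
      have hR : ∏ k ∈ Finset.Iio i, ((g : Torus N) k : ℂ) ^
          (Finsupp.single j (γ j - 1 - s) + γ.filter (j < ·)) k =
          ((g : Torus N) j : ℂ) ^ (γ j - 1 - s) *
            ∏ k ∈ Finset.Ioo j i, ((g : Torus N) k : ℂ) ^ γ k := by
        rw [← Finset.prod_subset hsub, hprod]
        · congr 1
          · simp
          · refine Finset.prod_congr rfl fun k hk => ?_
            rw [Finset.mem_Ioo] at hk
            simp [hk.1, hk.1.ne]
        · intro k hk hk'
          rw [Finset.mem_Iio] at hk
          have hkj : k < j := by
            by_contra hkj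
            exact hk' (Finset.mem_Ico.2 ⟨not_lt.1 hkj, hk⟩)
          simp [hkj.ne', hkj.le]
      -- The action of `g^{(j,i-1)}` contributes `λ_j^{γ_j-1}`, which turns `λ_j^{-s}` into the
      -- `λ_j^{γ_j-1-s}` of the splitting.
      rw [hα, hB, hinv, hR, pow_sub₀ _ hne (by omega : s ≤ γ j - 1), inv_pow]
      refine (congrArg (c * (((g : Torus N) j : ℂ) ^ s)⁻¹ * B * ·) hL).trans ?_
      ring

theorem edgeFactor_of_lt (W : Poly N) (g : G) {i j : Fin N} (h : j < i) :
    edgeFactor W g i j = SkewMonoidAlgebra.single 1 (edgePoly W (g : Torus N) i j) := by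
  rw [edgeFactor, secondOrder, if_neg h.ne', groupFactor, groupFactor]
  have h1 : oneCochain (qDiff (g : Torus N) i ∘ₗ qDiffBar ((g⁻¹ : G) : Torus N) j)
      (tildeComponent g i * tildeComponent g⁻¹ j) (fun _ => toAbar W) =
      SkewMonoidAlgebra.single (tildeComponent g i * tildeComponent g⁻¹ j)
        (qDiff (g : Torus N) i (qDiff ((g⁻¹ : G) : Torus N) j W)) := rfl
  rw [h1, SkewMonoidAlgebra.single_mul_single, SkewMonoidAlgebra.single_mul_single, one_mul,
    smul_one, mul_one, smul_qDiff_qDiff_eq_edgePoly W g h]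
  congr 1
  simp_rw [tildeComponent_inv]
  -- The group parts assemble to `g^{(j,i)}` times its inverse.
  have h2 : (∏ l ∈ Finset.Ico j i, tildeComponent g l) * tildeComponent g i =
      tildeComponent g j * ∏ l ∈ Finset.Ioc j i, tildeComponent g l := by
    rw [Finset.prod_Ico_mul_eq_prod_Icc h.le, Finset.mul_prod_Ioc_eq_prod_Icc h.le]
  rw [← mul_assoc, h2, Finset.prod_inv_distrib, mul_inv_cancel_comm, mul_inv_cancel]

/-- In a word of length two a gap would have to be at position `0`, but a variable there has no
earlier letter. -/
theorem vanishesOn_hasGap_two (χ : Cochain S 2) : VanishesOn HasGap χ := by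
  rintro U ℓ a ha ⟨k, hk, m, hm, hkm⟩
  have hm2 := ha.subset m hm
  obtain ⟨r, -, hr, -⟩ := ha.exists_before ⟨k, by omega⟩ hk
  rw [Fin.lt_def] at hr
  simp only at hr
  omega

theorem altEval_one (χ : Cochain S (2 * 1)) (u : Fin 1 → Abar N) (f : Fin 1 → Fin N) :
    altEval χ u f = χ ![u 0, toAbar (MvPolynomial.X (f 0))] := by
  rw [altEval, Fintype.sum_unique, Subsingleton.elim (default : Equiv.Perm (Fin 1)) 1,
    Equiv.Perm.sign_one, Units.val_one, Int.cast_one, one_smul]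
  congr 1
  funext k
  match k with
  | 0 => rfl
  | 1 => rfl

/-- This is the recursion step from the empty word, since `d_W` of a `1`-cochain is its value on
`W`. -/
theorem hStar_apply_two {W : Poly N} {E : Type} [Fintype E] (D : Splitting W E)
    (χ : Cochain S 2) :
    hStar χ (fun _ => toAbar W) =
      (-1 : ℂ) • ∑ e, χ ![toAbar (D.u e), toAbar (MvPolynomial.X (D.lab e))] *
        inclA S (D.v e) := by
  have h := altEval_dW_hStar (t := 0) D χ (vanishesOn_hasGap_two χ) Fin.elim0 1
  rw [altEval, Fintype.sum_unique, Subsingleton.elim (default : Equiv.Perm (Fin 0)) 1,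
    Equiv.Perm.sign_one, Units.val_one, Int.cast_one, one_smul, dW_apply, Fin.sum_univ_one] at h
  refine Eq.trans ?_ (h.trans ?_)
  · rw [Fin.val_zero, pow_zero, one_smul]
    congr 1
    funext k
    match k with
    | 0 => rfl
  · refine congrArg (fun y => (-1 : ℂ) • y) (Finset.sum_congr rfl fun e _ => ?_)
    exact congrArg (· * inclA S (D.v e)) (altEval_one χ _ _)

theorem firstOrder_apply (g : G) (i : Fin N) (a : Fin 1 → Abar N) :
    firstOrder g i a = SkewMonoidAlgebra.single (tildeComponent g i)
      (qDiffBar (g : Torus N) i (a 0)) := rfl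

theorem qDiff_X (g : Torus N) (i l : Fin N) :
    qDiff g i (MvPolynomial.X l) = if l = i then 1 else 0 := by
  rw [MvPolynomial.X, qDiff_monomial]
  split_ifs with h
  · subst h
    simp
  · simp [h]

/-- The sign in the definition of `∂_{i,i}` cancels that of `H^*`. The second derivative of a
variable selects the label `i`, and the first agrees with the twisted splitting because `u_e` has no
variable before `x_i`. -/
theorem edgeFactor_self (W : Poly N) (g : G) (i : Fin N) :
    edgeFactor W g i i = SkewMonoidAlgebra.single 1 (edgePoly W (g : Torus N) i i) := by
  have h0 : ∀ h : G, groupFactor h (∅ : Finset (Fin N)) = 1 := fun h => by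
    rw [groupFactor, Finset.prod_empty]; rfl
  rw [edgeFactor, secondOrder, if_pos rfl, Finset.Ico_self, Finset.Ioc_self, h0, h0, one_mul,
    mul_one, edgePoly_eq_sum (monomialSplitting W), ← inclA_apply, map_sum]
  have h1 := hStar_apply_two (monomialSplitting W) (cup (firstOrder g i) (firstOrder g⁻¹ i))
  change -(hStar (cup (firstOrder g i) (firstOrder g⁻¹ i)) (fun _ => toAbar W)) = _
  rw [h1, neg_one_smul, neg_neg]
  refine Finset.sum_congr rfl fun e _ => ?_
  rw [cup_apply, firstOrder_apply, firstOrder_apply]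
  change SkewMonoidAlgebra.single _ (qDiff (g : Torus N) i ((monomialSplitting W).u e)) *
    SkewMonoidAlgebra.single _ (qDiff ((g⁻¹ : G) : Torus N) i
      (MvPolynomial.X ((monomialSplitting W).lab e))) * _ = _
  rw [qDiff_X, tildeComponent_inv]
  split_ifs with he
  swap
  · simp
  rw [SkewMonoidAlgebra.single_mul_single, mul_inv_cancel, smul_one, mul_one, ← inclA_apply,
    ← inclA_mul]
  congr 2
  subst he
  obtain ⟨l, γ, s⟩ := e
  simp only [monomialSplitting]
  rw [qDiff_monomial, twistMul_split_monomial, Finset.prod_eq_one, mul_one]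
  intro k hk
  rw [Finset.mem_Iio] at hk
  simp [hk.ne, hk.le]

theorem edgeFactor_eq_single (W : Poly N) (g : G) {i j : Fin N} (h : j ≤ i) :
    edgeFactor W g i j = SkewMonoidAlgebra.single 1 (edgePoly W (g : Torus N) i j) := by
  rcases h.lt_or_eq with h | rfl
  · exact edgeFactor_of_lt W g h
  · exact edgeFactor_self W g _

/-! ### The value on the cup product -/

theorem lof_apply_cast {p n : ℕ} (h : p = n) (c : Cochain S p) (a : Fin n → Abar N) :
    DirectSum.lof ℂ ℕ (fun p => Cochain S p) p c n a = c fun k => a (Fin.cast h k) := by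
  subst h
  rw [DirectSum.lof_apply]
  rfl

/-- The second block consists of variables, so its splitting only tests `J = f`, and the group parts
`g` and `g⁻¹` cancel. -/
theorem sectorCup_goodWord (g : G) {p : ℕ} (I J : Fin p ↪o Fin N) (u : Fin p → Abar N)
    (f : Fin p → Fin N) :
    sectorCup g I J (2 * p) (goodWord u f) =
      if ⇑J = f then inclA G (twistMul (g : Torus N) (∏ k, splitBar (I k) (u k))) else 0 := by
  rw [sectorCup, lof_apply_cast (two_mul p).symm, cup_apply, upsilonStar_koszulGen,
    upsilonStar_koszulGen, contract_mulRight_single, contract_mulRight_single]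
  have h1 : ∀ k : Fin p, goodWord u f (Fin.cast (two_mul p).symm (Fin.castAdd p k)) = u k :=
    fun k => by
      rw [goodWord, dif_pos (by simp)]
      rfl
  have h2 : ∀ k : Fin p, goodWord u f (Fin.cast (two_mul p).symm (Fin.natAdd p k)) =
      toAbar (MvPolynomial.X (f k)) := fun k => by
    rw [goodWord, dif_neg (by simp)]
    congr 3
    ext
    simp
  simp_rw [h1]
  rw [splitBar_prod_eq_zero_or_one J f _ h2]
  split_ifs
  · rw [map_one, SkewMonoidAlgebra.single_mul_single, smul_one, mul_one, mul_inv_cancel]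
    rfl
  · simp

/-- Reversing `p + 1` letters means reversing the last `p` and moving the first one to the end,
which adds `p` to the exponent. -/
theorem sign_revPerm (p : ℕ) :
    Equiv.Perm.sign (Fin.revPerm : Equiv.Perm (Fin p)) = (-1) ^ (p * (p - 1) / 2) := by
  induction p with
  | zero => rw [Subsingleton.elim (Fin.revPerm : Equiv.Perm (Fin 0)) 1]; simp
  | succ p ih =>
    have h : (Fin.revPerm : Equiv.Perm (Fin (p + 1))) = insertPerm (Fin.revPerm, Fin.last p) := by
      have h1 := cons_comp_insertPerm (0 : Fin (p + 1)) Fin.succ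
        ((Fin.revPerm : Equiv.Perm (Fin p)), Fin.last p)
      have h2 : (Fin.cons 0 Fin.succ : Fin (p + 1) → Fin (p + 1)) = id := by
        funext k
        refine Fin.cases ?_ (fun k => ?_) k <;> simp
      rw [h2, Function.id_comp] at h1
      ext k : 1
      rw [h1]
      refine Fin.lastCases ?_ (fun k => ?_) k
      · simp
      · simp [Fin.insertNth_last', Fin.rev_castSucc]
    rw [h, sign_insertPerm, ih, ← pow_add, Fin.val_last, ← Finset.sum_range_id,
      ← Finset.sum_range_succ, Finset.sum_range_id]

theorem sum_prod_edgePoly {W : Poly N} {E : Type} [Fintype E] (D : Splitting W E) (g : Torus N)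
    {p : ℕ} (I J : Fin p → Fin N) :
    ∑ e : Fin p → E, (if J = fun k => D.lab (e k) then
      ∏ k, (twistMul g (split (I k) (D.u (e k))) * D.v (e k)) else 0) =
      ∏ k, edgePoly W g (I k) (J k) := by
  classical
  simp_rw [edgePoly_eq_sum D]
  rw [Finset.prod_univ_sum, Fintype.piFinset_univ]
  refine Finset.sum_congr rfl fun e _ => ?_
  rw [Finset.prod_ite_zero]
  simp [funext_iff, eq_comm]

theorem totalEval_sectorCup {W : Poly N} {E : Type} [Fintype E] (D : Splitting W E) (g : G)
    {p : ℕ} (I J : Fin p ↪o Fin N) :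
    totalEval D (sectorCup g I J (2 * p)) = inclA G ((-1 : ℂ) ^ (p * (p - 1) / 2) •
      ∑ σ : Equiv.Perm (Fin p), ((Equiv.Perm.sign σ : ℤ) : ℂ) •
        ∏ k, edgePoly W (g : Torus N) (I k) (J (σ k))) := by
  have hrev : ∀ e : Fin p → E, altEval (sectorCup g I J (2 * p))
      (fun k => toAbar (D.u (e k))) (fun k => D.lab (e k.rev)) =
      (-1 : ℂ) ^ (p * (p - 1) / 2) • altEval (sectorCup g I J (2 * p))
        (fun k => toAbar (D.u (e k))) (fun k => D.lab (e k)) := by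
    intro e
    have h := altEval_comp (sectorCup g I J (2 * p)) (fun k => toAbar (D.u (e k)))
      (fun k => D.lab (e k)) Fin.revPerm
    rw [sign_revPerm] at h
    refine h.trans ?_
    congr 1
    simp
  rw [totalEval, map_smul]
  simp_rw [hrev, smul_mul_assoc]
  rw [← Finset.smul_sum]
  refine congrArg (fun y => (-1 : ℂ) ^ (p * (p - 1) / 2) • y) ?_
  simp_rw [altEval, sectorCup_goodWord, Finset.sum_mul, smul_mul_assoc, ite_mul, zero_mul,
    ← inclA_mul, splitBar_toAbar, map_prod, ← Finset.prod_mul_distrib]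
  -- Passing to `σ⁻¹` turns the condition that `J` is the permuted list of labels into one fixing
  -- the label of `e k` as `J (σ k)`.
  rw [Finset.sum_comm, map_sum, ← Equiv.sum_comp (Equiv.inv (Equiv.Perm (Fin p)))]
  refine Finset.sum_congr rfl fun σ _ => ?_
  rw [← Finset.smul_sum, map_smul, Equiv.inv_apply, Equiv.Perm.sign_inv,
    ← sum_prod_edgePoly D (g : Torus N) I (fun k => J (σ k)), map_sum]
  refine congrArg (fun y => ((Equiv.Perm.sign σ : ℤ) : ℂ) • y)
    (Finset.sum_congr rfl fun e _ => ?_)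
  have hiff : (⇑J = (fun k => D.lab (e k)) ∘ ⇑(σ⁻¹)) ↔ (fun k => J (σ k)) = fun k => D.lab (e k) :=
    (Equiv.eq_comp_symm σ _ _)
  simp only [hiff]
  split_ifs
  · rfl
  · rw [map_zero]

/-- The signed sum over graphs is an element of the identity sector. -/
theorem graphSum_eq_inclA (W : Poly N) (g : G) {p : ℕ} (I J : Fin p ↪o Fin N) :
    graphSum W g I J = inclA (tildeGroup G) ((-1 : ℂ) ^ (p * (p - 1) / 2) •
      ∑ σ : Equiv.Perm (Fin p), ((Equiv.Perm.sign σ : ℤ) : ℂ) •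
        ∏ k, edgePoly W (g : Torus N) (I k) (J (σ k))) := by
  rw [graphSum, map_smul, map_sum, Finset.sum_filter]
  refine congrArg (fun y => (-1 : ℂ) ^ (p * (p - 1) / 2) • y)
    (Finset.sum_congr rfl fun σ _ => ?_)
  rw [map_smul]
  split_ifs with h
  · refine congrArg (fun y => ((Equiv.Perm.sign σ : ℤ) : ℂ) • y) ?_
    simp_rw [edgeFactor_eq_single W g (h _)]
    rw [← List.prod_ofFn, inclA_apply]
    change _ = SkewMonoidAlgebra.singleOneRingHom _
    rw [map_list_prod, List.map_ofFn]
    rfl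
  -- A permutation outside `V` has a pair with `I k < J (σ k)`, whose polynomial is zero.
  · push Not at h
    obtain ⟨k, hk⟩ := h
    rw [Finset.prod_eq_zero (Finset.mem_univ k) (edgePoly_of_lt W _ hk), map_zero, smul_zero]

end OrbifoldLG

end

theorem mainTheorem8 {N : ℕ} (W : OrbifoldLG.Poly N) (G : Subgroup (OrbifoldLG.Torus N))
    (hW : ∀ t ∈ G, t • W = W) (g : G) :
    (∀ (p q : ℕ) (i : Fin p ↪o Fin N) (j : Fin q ↪o Fin N), p ≠ q →
      OrbifoldLG.projJac W (OrbifoldLG.phiTilde W (OrbifoldLG.sectorCup g i j)) = 0) ∧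
    (∀ (p : ℕ) (i j : Fin p ↪o Fin N), ∃ f : OrbifoldLG.Poly N,
      OrbifoldLG.graphSum W g i j = SkewMonoidAlgebra.single 1 f ∧
      OrbifoldLG.projJac W (OrbifoldLG.phiTilde W (OrbifoldLG.sectorCup g i j)) =
        Ideal.Quotient.mk _ f) := by
  refine ⟨fun p q i j hpq => ?_, fun p i j => ⟨_, OrbifoldLG.graphSum_eq_inclA W g i j, ?_⟩⟩
  · rw [OrbifoldLG.projJac, OrbifoldLG.phiTilde_sectorCup_of_ne W g hpq,
      SkewMonoidAlgebra.coeff_zero, Finsupp.zero_apply, map_zero]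
  -- Both sides are the same polynomial already in `A`, before passing to `Jac(W)`.
  · rw [OrbifoldLG.projJac,
      OrbifoldLG.phiTilde_sectorCup_eq_totalEval (OrbifoldLG.monomialSplitting W),
      OrbifoldLG.totalEval_sectorCup, OrbifoldLG.inclA_apply, SkewMonoidAlgebra.coeff_single,
      Finsupp.single_eq_same]
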